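/- Let $K\ge 1$, $\mathcal K=\{1,\dots,K\}$, and for $k\in\mathcal K$ let $\lambda_k,p_k,\mu_k>0$, $\alpha_k>2$, and let $P_{k0},\Delta_k,P_{bh}$ be such that $c_k:=P_{k0}+\Delta_kp_k+P_{bh}>0$; let $\tau_0\in\mathbb R$. The base stations of tier $k$ form a homogeneous Poisson point process $\Phi_k=\{x_{k,i}\}_i$ of density $\lambda_k$ in $\mathbb R^2$, the tiers being independent. The fading coefficients $\Psi_{k,i}$ are independent of each other and of all locations, and $\Psi_{k,i}$ is exponentially distributed with rate $1/\mu_k$. In the geometric clustering model with radii $R=(R_k)_{k\in\mathcal K}\in(0,\infty)^K$, the cooperating base stations of tier $k$ are those in the disc $b(o,R_k)$. Put $$J_S=\sum_k\sum_{\|x_{k,i}\|\le R_k}p_k\Psi_{k,i}\|x_{k,i}\|^{-\alpha_k},\qquad J_I=\sum_k\sum_{\|x_{k,i}\|>R_k}p_k\Psi_{k,i}\|x_{k,i}\|^{-\alpha_k}.$$ The spatial average rate without noise is $\tau(R)=\mathbb E[\ln(1+J_S/J_I)]$, and the average intra-cluster power consumption is $\tilde P_{cl}(R)=\sum_k\mathbb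 E\big[\#(\Phi_k\cap b(o,R_k))\big]\,c_k$. Let $$\underline\tau(R)=\int_0^\infty\frac1t\Big(e^{-t\,\mathbb E[J_I]}-\mathbb E\big[e^{-t(J_S+J_I)}\big]\Big)dt,$$ which arises from the exact formula for $\tau(R)$ by replacing $1-e^{-u}$ with $u$ in the exponent of the Laplace transform of the interference $J_I$. Then $\mathbb E[J_I]$ is finite, the integral defining $\underline\tau(R)$ converges absolutely, and $\tau(R)\ge\underline\tau(R)$ for all $R\in(0,\infty)^K$. Call $R^*\in(0,\infty)^K$ optimal if it minimizes $\tilde P_{cl}(R)$ among all $R\in(0,\infty)^K$ with $\underline\tau(R)\ge\tau_0$. Exactly one optimal $R^*$ exists, it satisfies $\tau(R^*)\ge\tau_0$, and, for every $l\in\mathcal K$, a vector $R^*\in(0,\infty)^K$ is optimal if and only if $$\sum_{j=1}^K\tilde B_j\,\tilde\Omega_{j\to k}^{\frac{\alpha_j-2}{\alpha_j}}\,(R_k^*)^{\frac{\alpha_k(2-\alpha_j)}{\alpha_j}}=\tilde D_l\,e^{\frac{\alpha_l-2}{2}C+\tilde\Theta_l-\tau_0}\qquad\text{for all }k\in\mathcal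 K,$$ where $C$ is Euler's constant and $$\tilde B_k=\frac{(\alpha_K-2)p_k\mu_k\lambda_k}{(\alpha_k-2)p_K\mu_K\lambda_K},\qquad \tilde\Omega_{j\to k}=\frac{c_j\,p_k\mu_k}{c_k\,p_j\mu_j},\qquad \tilde D_l=\frac{\tilde\omega_l^{\alpha_l/2}}{\frac{2\pi}{\alpha_K-2}\lambda_Kp_K\mu_K},$$ $$\tilde\Theta_l=\int_0^\infty\frac{\exp(-\tilde\omega_lt^{2/\alpha_l})}{t}\Big[1-\exp\Big(-\sum_{k\ne l}\tilde\omega_kt^{2/\alpha_k}\Big)\Big]dt,\qquad \tilde\omega_k=\frac{2\pi^2}{\alpha_k}\csc\Big(\frac{2\pi}{\alpha_k}\Big)\lambda_k(p_k\mu_k)^{2/\alpha_k},$$ the integral defining $\tilde\Theta_l$ being absolutely convergent. -/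

import Mathlib

open MeasureTheory ProbabilityTheory Set
open scoped ENNReal NNReal

noncomputable section

/-- The parameters of a network with `K = n + 1` tiers: densities, transmit powers, path loss
exponents, mean fading coefficients, static powers, slopes of the load-dependent power, and the
backhaul power per base station. The power consumed by a base station of each tier is positive. -/
structure HetNet (n : ℕ) where
  lam : Fin (n + 1) → ℝ
  p : Fin (n + 1) → ℝ
  alpha : Fin (n + 1) → ℝ
  mu : Fin (n + 1) → ℝ
  P0 : Fin (n + 1) → ℝ
  Delta : Fin (n + 1) → ℝ
  Pbh : ℝ
  lam_pos : ∀ k, 0 < lam k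
  p_pos : ∀ k, 0 < p k
  two_lt_alpha : ∀ k, 2 < alpha k
  mu_pos : ∀ k, 0 < mu k
  power_pos : ∀ k, 0 < P0 k + Delta k * p k + Pbh

/-- The plane, with its Euclidean norm. -/
abbrev Plane : Type := EuclideanSpace ℝ (Fin 2)

/-- The number of points of the (enumerated) point process `x` that lie in `A`. -/
def pointCount {Ω : Type*} (x : ℕ → Ω → Plane) (A : Set Plane) (ω : Ω) : ℝ≥0∞ :=
  ∑' i, A.indicator (fun _ => (1 : ℝ≥0∞)) (x i ω)

/-- `x` enumerates the points of a homogeneous Poisson point process of density `lam`. -/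
structure IsHomogeneousPPP {Ω : Type*} [MeasurableSpace Ω] (P : Measure Ω) (lam : ℝ)
    (x : ℕ → Ω → Plane) : Prop where
  measurable : ∀ i, Measurable (x i)
  poisson : ∀ A : Set Plane, MeasurableSet A → volume A ≠ ∞ →
    P.map (pointCount x A) =
      (poissonMeasure (ENNReal.ofReal lam * volume A).toNNReal).map (fun m : ℕ => (m : ℝ≥0∞))
  indep : ∀ (m : ℕ) (A : Fin m → Set Plane), (∀ j, MeasurableSet (A j)) →
    (∀ j, volume (A j) ≠ ∞) → Pairwise (fun i j => Disjoint (A i) (A j)) →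
    iIndepFun (fun j => pointCount x (A j)) P

/-- The random network: the tiers `x k` are independent homogeneous Poisson point processes and the
fading coefficients `Psi k i` are independent of each other and of all locations, those of tier `k`
being exponentially distributed with rate `1 / mu k`, that is, with mean `mu k`. -/
structure IsNetworkModel {Ω : Type*} [MeasurableSpace Ω] {n : ℕ} (N : HetNet n) (P : Measure Ω)
    (x : Fin (n + 1) → ℕ → Ω → Plane) (Psi : Fin (n + 1) → ℕ → Ω → ℝ) : Prop where
  ppp : ∀ k, IsHomogeneousPPP P (N.lam k) (x k)
  indep_tiers : iIndepFun (fun k ω => fun i => x k i ω) P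
  fading_measurable : ∀ k i, Measurable (Psi k i)
  fading_law : ∀ k i, P.map (Psi k i) = expMeasure (1 / N.mu k)
  fading_indep : iIndepFun (fun ki : Fin (n + 1) × ℕ => Psi ki.1 ki.2) P
  locations_indep_fading : IndepFun (fun ω k i => x k i ω) (fun ω k i => Psi k i ω) P

namespace HetNet

section Model

variable {Ω : Type*} {n : ℕ} (N : HetNet n)
  (x : Fin (n + 1) → ℕ → Ω → Plane) (Psi : Fin (n + 1) → ℕ → Ω → ℝ)

/-- The power received at the origin from the `i`-th base station of tier `k`. -/
def received (k : Fin (n + 1)) (i : ℕ) (ω : Ω) : ℝ≥0∞ :=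
  ENNReal.ofReal (N.p k * Psi k i ω * ‖x k i ω‖ ^ (-N.alpha k))

open Classical in
/-- The power received from the cooperating base stations, which are those of each tier `k` in the
disc of radius `R k` about the origin. -/
def signal (R : Fin (n + 1) → ℝ) (ω : Ω) : ℝ≥0∞ :=
  ∑ k, ∑' i, if x k i ω ∈ Metric.closedBall (0 : Plane) (R k) then N.received x Psi k i ω else 0

open Classical in
/-- The power received from all other base stations. -/
def interference (R : Fin (n + 1) → ℝ) (ω : Ω) : ℝ≥0∞ :=
  ∑ k, ∑' i, if x k i ω ∈ Metric.closedBall (0 : Plane) (R k) then 0 else N.received x Psi k i ω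

/-- The ratio of signal and interference (no noise). -/
def sir (R : Fin (n + 1) → ℝ) (ω : Ω) : ℝ≥0∞ :=
  N.signal x Psi R ω / N.interference x Psi R ω

variable [MeasurableSpace Ω] (P : Measure Ω)

/-- The spatial average rate `E[ln (1 + SIR)]`. -/
def rate (R : Fin (n + 1) → ℝ) : ℝ≥0∞ :=
  ∫⁻ ω, (ENNReal.log (1 + N.sir x Psi R ω)).toENNReal ∂P

/-- The mean interference. -/
def meanInterference (R : Fin (n + 1) → ℝ) : ℝ≥0∞ :=
  ∫⁻ ω, N.interference x Psi R ω ∂P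

/-- The Laplace transform at `t` of the total power received at the origin. -/
def laplaceTotal (R : Fin (n + 1) → ℝ) (t : ℝ) : ℝ :=
  ∫ ω, Real.exp (-t * (N.signal x Psi R ω + N.interference x Psi R ω).toReal) ∂P

/-- The integrand of `rateBound`. The integrand of the exact rate has in place of its first term the
Laplace transform `exp (-∑ k, lam k * ∫ (1 - E exp (-t p Psi ‖y‖ ^ (-alpha))) dy)` of the
interference (integral over `‖y‖ > R k`); here `1 - exp (-u)` is replaced by its upper bound `u`,
which turns the exponent into `-t` times the mean interference. -/
def rateBoundIntegrand (R : Fin (n + 1) → ℝ) (t : ℝ) : ℝ :=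
  (Real.exp (-t * (N.meanInterference x Psi P R).toReal) - N.laplaceTotal x Psi P R t) / t

/-- The analytic lower bound of the spatial average rate. -/
def rateBound (R : Fin (n + 1) → ℝ) : ℝ :=
  ∫ t in Ioi (0 : ℝ), N.rateBoundIntegrand x Psi P R t

/-- The average intra-cluster power consumption: the mean number of cooperating base stations of
each tier, times the power that each of them consumes. -/
def clusterPower (R : Fin (n + 1) → ℝ) : ℝ≥0∞ :=
  ∑ k, (∫⁻ ω, pointCount (x k) (Metric.closedBall 0 (R k)) ω ∂P) *
    ENNReal.ofReal (N.P0 k + N.Delta k * N.p k + N.Pbh)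

/-- Positive radii for which the lower bound of the rate is at least `tau0`. -/
def Feasible (tau0 : ℝ) (R : Fin (n + 1) → ℝ) : Prop :=
  (∀ k, 0 < R k) ∧ tau0 ≤ N.rateBound x Psi P R

/-- Radii that minimize the intra-cluster power consumption among all feasible ones. -/
def IsOptimal (tau0 : ℝ) (R : Fin (n + 1) → ℝ) : Prop :=
  N.Feasible x Psi P tau0 R ∧
    ∀ R' : Fin (n + 1) → ℝ, N.Feasible x Psi P tau0 R' →
      N.clusterPower x P R ≤ N.clusterPower x P R'

end Model

section Constants

variable {n : ℕ} (N : HetNet n)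

def omegaT (k : Fin (n + 1)) : ℝ :=
  2 * Real.pi ^ 2 / N.alpha k * (1 / Real.sin (2 * Real.pi / N.alpha k)) * N.lam k *
    (N.p k * N.mu k) ^ (2 / N.alpha k)

def BT (k : Fin (n + 1)) : ℝ :=
  ((N.alpha (Fin.last n) - 2) * N.p k * N.mu k * N.lam k) /
    ((N.alpha k - 2) * N.p (Fin.last n) * N.mu (Fin.last n) * N.lam (Fin.last n))

def OmegaT (j k : Fin (n + 1)) : ℝ :=
  ((N.P0 j + N.Delta j * N.p j + N.Pbh) * N.p k * N.mu k) /
    ((N.P0 k + N.Delta k * N.p k + N.Pbh) * N.p j * N.mu j)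

def ThetaTIntegrand (l : Fin (n + 1)) (t : ℝ) : ℝ :=
  Real.exp (-N.omegaT l * t ^ (2 / N.alpha l)) / t *
    (1 - Real.exp (-∑ k ∈ Finset.univ.erase l, N.omegaT k * t ^ (2 / N.alpha k)))

def ThetaT (l : Fin (n + 1)) : ℝ :=
  ∫ t in Ioi (0 : ℝ), N.ThetaTIntegrand l t

def DT (l : Fin (n + 1)) : ℝ :=
  N.omegaT l ^ (N.alpha l / 2) /
    (2 * Real.pi / (N.alpha (Fin.last n) - 2) * N.lam (Fin.last n) * N.p (Fin.last n) *
      N.mu (Fin.last n))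

end Constants

end HetNet

end

/-! The total power $J_S+J_I$ does not involve the radii. Exponential fading and the Laplace
functional of a Poisson process give $E[e^{-t(J_S+J_I)}]=\exp(-\sum_k\tilde\omega_kt^{2/\alpha_k})$,
the cosecant coming from a beta integral (`lintegral_negExp_total`). Campbell's formula gives
$E[J_I]=m(R)=\sum_kA_kR_k^{2-\alpha_k}$ (`meanInterference_eq`). So $\underline\tau$ depends on $R$
only through $m(R)$. Splitting off tier $l$ leaves $\tilde\Theta_l$ and a Frullani-type integral,
hence $\underline\tau(R)=\mathrm{const}_l-\ln m(R)$ (`rateBound_eq`), and feasibility means $m(R)\le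
M$.

The bound $\underline\tau\le\tau$ needs no exact formula for $\tau$: Jensen gives $e^{-tE[J_I]}\le
E[e^{-tJ_I}]$, and after Tonelli the inner $t$-integral is Frullani's for $\ln(1+J_S/J_I)$
(`rateBound_le_rate`).

It remains to minimize $\sum_kA_k\frac{\alpha_k-2}{2q_k}R_k^2$ under $m(R)\le M$, where
$q_k=p_k\mu_k/c_k$. If $R_k^{\alpha_k}=\kappa q_k$ with $\kappa>0$, every coordinate of the
Lagrangian with multiplier $\kappa$ has its strict minimum at $R_k$ (`lagrangian_lt`). Such an $R$
with $m(R)=M$ therefore beats every other feasible vector. On this curve $m$ is strictly decreasing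
in $\kappa$ and takes every positive value, so exactly one $\kappa$ fits. The $k$-th equation of the
system says that $R_k^{\alpha_k}/q_k$ is this $\kappa$ (`system_iff`). -/

/-! ### The exponential on $[0,\infty]$ and Poisson moments -/

/-- The function `u ↦ exp (-u)` on `[0, ∞]`. -/
noncomputable def negExp (u : ℝ≥0∞) : ℝ≥0∞ := EReal.exp (-(u : EReal))

theorem negExp_zero : negExp 0 = 1 := by simp [negExp]

theorem negExp_add (u v : ℝ≥0∞) : negExp (u + v) = negExp u * negExp v := by
  rw [negExp, negExp, negExp, ← EReal.exp_add, EReal.coe_ennreal_add, EReal.neg_add, sub_eq_add_neg]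
  · left; exact EReal.coe_ennreal_ne_bot u
  · right; exact EReal.coe_ennreal_ne_bot v

theorem negExp_sum {ι : Type*} (s : Finset ι) (f : ι → ℝ≥0∞) :
    negExp (∑ i ∈ s, f i) = ∏ i ∈ s, negExp (f i) := by
  classical
  induction s using Finset.induction_on with
  | empty => simp [negExp_zero]
  | insert a s ha ih => rw [Finset.sum_insert ha, Finset.prod_insert ha, negExp_add, ih]

theorem negExp_mul_nat (u : ℝ≥0∞) (m : ℕ) : negExp (u * m) = negExp u ^ m := by
  have := negExp_sum (Finset.range m) (fun _ => u)
  simpa [mul_comm] using this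

theorem negExp_ofReal {a : ℝ} (ha : 0 ≤ a) :
    negExp (ENNReal.ofReal a) = ENNReal.ofReal (Real.exp (-a)) := by
  rw [negExp, EReal.coe_ennreal_ofReal, max_eq_left ha, ← EReal.coe_neg, EReal.exp_coe]

theorem negExp_of_ne_top {u : ℝ≥0∞} (hu : u ≠ ⊤) :
    negExp u = ENNReal.ofReal (Real.exp (-u.toReal)) := by
  rw [← negExp_ofReal ENNReal.toReal_nonneg, ENNReal.ofReal_toReal hu]

theorem continuous_negExp : Continuous negExp :=
  ENNReal.continuous_exp.comp (continuous_neg.comp continuous_coe_ennreal_ereal)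

theorem measurable_negExp : Measurable negExp := continuous_negExp.measurable

theorem antitone_negExp : Antitone negExp := fun u v h => by
  apply EReal.exp_monotone
  simpa using h

theorem negExp_le_one (u : ℝ≥0∞) : negExp u ≤ 1 := by
  rw [← negExp_zero]; exact antitone_negExp zero_le

theorem negExp_ne_top (u : ℝ≥0∞) : negExp u ≠ ⊤ :=
  ((negExp_le_one u).trans_lt ENNReal.one_lt_top).ne

theorem lintegral_poissonMeasure (r : ℝ≥0) (f : ℕ → ℝ≥0∞) :
    ∫⁻ m, f m ∂(poissonMeasure r) =
      ∑' m, ENNReal.ofReal (Real.exp (-r) * r ^ m / m.factorial) * f m := by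
  rw [poissonMeasure, lintegral_sum_measure]
  simp

theorem lintegral_natCast_poissonMeasure (r : ℝ≥0) :
    ∫⁻ m, (m : ℝ≥0∞) ∂(poissonMeasure r) = r := by
  rw [lintegral_poissonMeasure, tsum_eq_zero_add' ENNReal.summable]
  simp only [Nat.cast_zero, mul_zero, zero_add]
  -- Size biasing: $(m+1)$ times the weight of $m+1$ is $r$ times the weight of $m$.
  have h : ∀ m : ℕ, ENNReal.ofReal (Real.exp (-r) * r ^ (m + 1) / (m + 1).factorial) *
      ((m + 1 : ℕ) : ℝ≥0∞) =
      r * ENNReal.ofReal (Real.exp (-r) * r ^ m / m.factorial) := fun m => by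
    rw [← ENNReal.ofReal_natCast, ← ENNReal.ofReal_mul (by positivity),
      ← ENNReal.ofReal_coe_nnreal (p := r), ← ENNReal.ofReal_mul (by positivity)]
    congr 1
    rw [Nat.factorial_succ]
    push_cast
    field_simp
    ring
  simp_rw [h]
  rw [ENNReal.tsum_mul_left, ← ENNReal.ofReal_tsum_of_nonneg (fun _ => by positivity)
    (hasSum_one_poissonMeasure r).summable, (hasSum_one_poissonMeasure r).tsum_eq]
  simp

/-- The probability generating function $e^{-r(1-z)}$ at $z=e^{-c}$; $c=\infty$ is allowed. -/
theorem lintegral_negExp_poissonMeasure (r : ℝ≥0) (c : ℝ≥0∞) :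
    ∫⁻ m, negExp (c * (m : ℝ≥0∞)) ∂(poissonMeasure r) = negExp (r * (1 - negExp c)) := by
  rw [lintegral_poissonMeasure]
  set z := (negExp c).toReal with hz
  have hzc : negExp c = ENNReal.ofReal z := (ENNReal.ofReal_toReal (negExp_ne_top c)).symm
  have hz0 : 0 ≤ z := ENNReal.toReal_nonneg
  have hz1 : z ≤ 1 := by
    have := ENNReal.toReal_mono ENNReal.one_ne_top (negExp_le_one c)
    simpa using this
  have h : ∀ m : ℕ, ENNReal.ofReal (Real.exp (-r) * r ^ m / m.factorial) *
      negExp (c * (m : ℝ≥0∞)) = ENNReal.ofReal (Real.exp (-r) * ((r * z) ^ m / m.factorial)) :=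
    fun m => by
    rw [negExp_mul_nat, hzc, ← ENNReal.ofReal_pow hz0, ← ENNReal.ofReal_mul (by positivity)]
    congr 1
    rw [mul_pow]; ring
  have hs := (NormedSpace.expSeries_div_hasSum_exp ((r : ℝ) * z)).mul_left (Real.exp (-r))
  simp_rw [h]
  rw [← ENNReal.ofReal_tsum_of_nonneg (fun _ => by positivity) hs.summable, hs.tsum_eq, hzc,
    ← ENNReal.ofReal_one, ← ENNReal.ofReal_sub _ hz0, ← ENNReal.ofReal_coe_nnreal (p := r),
    ← ENNReal.ofReal_mul r.coe_nonneg,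
    negExp_ofReal (mul_nonneg r.coe_nonneg (by linarith : 0 ≤ 1 - z)),
    ← Real.exp_eq_exp_ℝ, ← Real.exp_add]
  congr 2; ring

/-! ### Poisson processes: intensity and Laplace functional -/

section PPP

variable {Ω : Type*} [MeasurableSpace Ω] {P : Measure Ω} {lam : ℝ} {x : ℕ → Ω → Plane}

theorem IsHomogeneousPPP.measurable_pointCount (h : IsHomogeneousPPP P lam x) {A : Set Plane}
    (hA : MeasurableSet A) : Measurable (pointCount x A) :=
  Measurable.tsum fun i => (measurable_const.indicator hA).comp (h.measurable i)

theorem IsHomogeneousPPP.lintegral_comp_pointCount (h : IsHomogeneousPPP P lam x) {A : Set Plane}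
    (hA : MeasurableSet A) (hA' : volume A ≠ ∞) {f : ℝ≥0∞ → ℝ≥0∞} (hf : Measurable f) :
    ∫⁻ ω, f (pointCount x A ω) ∂P =
      ∫⁻ m : ℕ, f m ∂(poissonMeasure (ENNReal.ofReal lam * volume A).toNNReal) := by
  rw [← lintegral_map hf (h.measurable_pointCount hA), h.poisson A hA hA',
    lintegral_map hf .of_discrete]

theorem IsHomogeneousPPP.coe_toNNReal {A : Set Plane} (hA' : volume A ≠ ∞) :
    ((ENNReal.ofReal lam * volume A).toNNReal : ℝ≥0∞) = ENNReal.ofReal lam * volume A :=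
  ENNReal.coe_toNNReal (ENNReal.mul_ne_top ENNReal.ofReal_ne_top hA')

theorem IsHomogeneousPPP.lintegral_pointCount (h : IsHomogeneousPPP P lam x) {A : Set Plane}
    (hA : MeasurableSet A) (hA' : volume A ≠ ∞) :
    ∫⁻ ω, pointCount x A ω ∂P = ENNReal.ofReal lam * volume A := by
  rw [h.lintegral_comp_pointCount hA hA' (f := fun u => u) measurable_id]
  simp only [lintegral_natCast_poissonMeasure, IsHomogeneousPPP.coe_toNNReal hA']

theorem IsHomogeneousPPP.lintegral_negExp_pointCount (h : IsHomogeneousPPP P lam x) {A : Set Plane}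
    (hA : MeasurableSet A) (hA' : volume A ≠ ∞) (c : ℝ≥0∞) :
    ∫⁻ ω, negExp (c * pointCount x A ω) ∂P =
      negExp (ENNReal.ofReal lam * volume A * (1 - negExp c)) := by
  rw [h.lintegral_comp_pointCount hA hA' (f := fun u => negExp (c * u))
    (measurable_negExp.comp (measurable_const.mul measurable_id)),
    lintegral_negExp_poissonMeasure, IsHomogeneousPPP.coe_toNNReal hA']

/-- Reduces equality of measures to bounded sets, where the law of the counts is available. -/
theorem measure_eq_iSup_inter_closedBall (μ : Measure Plane) (A : Set Plane) :
    μ A = ⨆ n : ℕ, μ (A ∩ Metric.closedBall 0 n) := by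
  have hm : Monotone fun n : ℕ => A ∩ Metric.closedBall (0 : Plane) n := fun m n hmn =>
    inter_subset_inter_right _ (Metric.closedBall_subset_closedBall (by exact_mod_cast hmn))
  rw [← hm.measure_iUnion, ← inter_iUnion, Metric.iUnion_closedBall_nat, inter_univ]

/-- The intensity measure of a homogeneous Poisson point process. -/
theorem IsHomogeneousPPP.sum_map (h : IsHomogeneousPPP P lam x) :
    Measure.sum (fun i => P.map (x i)) = ENNReal.ofReal lam • volume := by
  have key : ∀ A : Set Plane, MeasurableSet A → volume A ≠ ∞ →
      Measure.sum (fun i => P.map (x i)) A = ENNReal.ofReal lam * volume A := fun A hA hA' => by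
    rw [Measure.sum_apply _ hA, ← h.lintegral_pointCount hA hA']
    simp only [pointCount]
    rw [lintegral_tsum (f := fun i ω => A.indicator (fun _ => 1) (x i ω)) fun i =>
      ((measurable_const.indicator hA).comp (h.measurable i)).aemeasurable]
    congr with i
    rw [← lintegral_map (measurable_const.indicator hA) (h.measurable i), lintegral_indicator hA]
    simp
  ext A hA
  rw [measure_eq_iSup_inter_closedBall, measure_eq_iSup_inter_closedBall (ENNReal.ofReal lam • _)]
  congr with n
  rw [key _ (hA.inter Metric.isClosed_closedBall.measurableSet)
    (measure_ne_top_of_subset inter_subset_right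
      (isCompact_closedBall (0 : Plane) n).measure_lt_top.ne)]
  simp

theorem IsHomogeneousPPP.lintegral_tsum_comp (h : IsHomogeneousPPP P lam x) {f : Plane → ℝ≥0∞}
    (hf : Measurable f) :
    ∑' i, ∫⁻ ω, f (x i ω) ∂P = ENNReal.ofReal lam * ∫⁻ y, f y := by
  have := congrArg (fun μ => ∫⁻ y, f y ∂μ) h.sum_map
  simp only [lintegral_sum_measure, lintegral_smul_measure, smul_eq_mul] at this
  rw [← this]
  congr with i
  rw [lintegral_map hf (h.measurable i)]

/-- For a step function on disjoint sets the sum over the points is $\sum_jc_jN(A_j)$ with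
independent Poisson counts, so the generating functions multiply. -/
theorem IsHomogeneousPPP.laplace_of_finite (h : IsHomogeneousPPP P lam x) {ι : Type*} [Fintype ι]
    (c : ι → ℝ≥0∞) (A : ι → Set Plane) (hA : ∀ j, MeasurableSet (A j))
    (hA' : ∀ j, volume (A j) ≠ ∞) (hd : Pairwise (fun i j => Disjoint (A i) (A j))) :
    ∫⁻ ω, negExp (∑' i, ∑ j, c j * (A j).indicator 1 (x i ω)) ∂P =
      negExp (ENNReal.ofReal lam * ∑ j, volume (A j) * (1 - negExp (c j))) := by
  have hi : iIndepFun (fun j => pointCount x (A j)) P := by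
    let e := Fintype.equivFin ι
    have := h.indep (Fintype.card ι) (fun m => A (e.symm m)) (fun j => hA _) (fun j => hA' _)
      (fun i j hij => hd (by simpa using hij))
    have h2 := iIndepFun.precomp e.injective this
    simpa using h2
  have h1 : ∀ ω, negExp (∑' i, ∑ j, c j * (A j).indicator 1 (x i ω)) =
      ∏ j, negExp (c j * pointCount x (A j) ω) := fun ω => by
    rw [← negExp_sum]
    congr 1
    rw [Summable.tsum_finsetSum fun _ _ => ENNReal.summable]
    refine Finset.sum_congr rfl fun j _ => ?_
    rw [ENNReal.tsum_mul_left]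
    rfl
  simp_rw [h1]
  have hmeas : ∀ j, Measurable fun u : ℝ≥0∞ => negExp (c j * u) := fun j =>
    measurable_negExp.comp (measurable_const.mul measurable_id)
  rw [lintegral_prod_eq_prod_lintegral_of_indepFun Finset.univ
    (fun j ω => negExp (c j * pointCount x (A j) ω)) (hi.comp _ hmeas)
    (fun j => (hmeas j).comp (h.measurable_pointCount (hA j)))]
  simp_rw [fun j => h.lintegral_negExp_pointCount (hA j) (hA' j)]
  rw [← negExp_sum, Finset.mul_sum]
  simp_rw [mul_assoc]

/-- Monotone convergence for the counting measure. -/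
theorem ENNReal.tsum_iSup_of_monotone {ι : Type*} {f : ℕ → ι → ℝ≥0∞} (hf : Monotone f) :
    ∑' i, ⨆ n, f n i = ⨆ n, ∑' i, f n i := by
  let _ : MeasurableSpace ι := ⊤
  simp_rw [← lintegral_count]
  exact lintegral_iSup (fun _ => measurable_from_top) hf

/-- The Laplace functional of a homogeneous Poisson point process. -/
theorem IsHomogeneousPPP.laplace [IsProbabilityMeasure P] (h : IsHomogeneousPPP P lam x)
    {f : Plane → ℝ≥0∞} (hf : Measurable f) :
    ∫⁻ ω, negExp (∑' i, f (x i ω)) ∂P =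
      negExp (ENNReal.ofReal lam * ∫⁻ y, (1 - negExp (f y))) := by
  set B : ℕ → Set Plane := fun n => Metric.closedBall 0 n with hB
  have hBm : ∀ n, MeasurableSet (B n) := fun n => Metric.isClosed_closedBall.measurableSet
  -- Cutting off at a ball gives the level sets finite volume, as `laplace_of_finite` demands.
  set g : ℕ → Plane → ℝ≥0∞ := fun n => (B n).indicator (SimpleFunc.eapprox f n) with hg
  have hgm : ∀ n, Measurable (g n) := fun n => (SimpleFunc.measurable _).indicator (hBm n)
  have hmono : Monotone g := fun m n hmn y => by
    have hs : B m ⊆ B n := Metric.closedBall_subset_closedBall (by exact_mod_cast hmn)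
    refine (indicator_le_indicator_of_subset hs (fun _ => zero_le) y).trans ?_
    exact indicator_le_indicator (SimpleFunc.monotone_eapprox f hmn y)
  have hsup : ∀ y, ⨆ n, g n y = f y := fun y => by
    refine le_antisymm (iSup_le fun n => (indicator_le_self _ _ y).trans ?_) ?_
    · rw [← SimpleFunc.iSup_eapprox_apply hf y]
      exact le_iSup (fun n => (SimpleFunc.eapprox f n) y) n
    · rw [← SimpleFunc.iSup_eapprox_apply hf y]
      refine iSup_le fun n => ?_
      obtain ⟨m, hm⟩ := exists_nat_ge ‖y‖
      have hy : y ∈ B (max m n) := by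
        simp only [hB, Metric.mem_closedBall, dist_zero_right]
        exact hm.trans (by exact_mod_cast le_max_left m n)
      refine le_trans ?_ (le_iSup _ (max m n))
      simp only [hg, indicator_of_mem hy]
      exact SimpleFunc.monotone_eapprox f (le_max_right m n) y
  have hfin : ∀ n, ∫⁻ ω, negExp (∑' i, g n (x i ω)) ∂P =
      negExp (ENNReal.ofReal lam * ∫⁻ y, (1 - negExp (g n y))) := fun n => by
    set s := SimpleFunc.eapprox f n with hs
    set A : s.range → Set Plane := fun c => B n ∩ s ⁻¹' {c.1} with hAd
    have hAm : ∀ c, MeasurableSet (A c) := fun c => (hBm n).inter (s.measurableSet_fiber _)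
    have hAv : ∀ c, volume (A c) ≠ ∞ := fun c => measure_ne_top_of_subset inter_subset_left
      (isCompact_closedBall (0 : Plane) n).measure_lt_top.ne
    have hAd : Pairwise (fun i j => Disjoint (A i) (A j)) := fun c d hcd => by
      refine Set.disjoint_left.2 ?_
      rintro y ⟨-, hy⟩ ⟨-, hy'⟩
      simp only [mem_preimage, mem_singleton_iff] at hy hy'
      exact hcd (Subtype.ext (hy.symm.trans hy'))
    -- Used for the identity and for $1-e^{-u}$. Both vanish at $0$, the value of `g n` outside the
    -- ball.
    have hF : ∀ (F : ℝ≥0∞ → ℝ≥0∞), F 0 = 0 → ∀ y, F (g n y) =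
        ∑ c : s.range, F c.1 * (A c).indicator 1 y := fun F hF0 y => by
      by_cases hy : y ∈ B n
      · rw [Finset.sum_eq_single (⟨s y, s.mem_range_self y⟩ : s.range)]
        · simp [hg, hy, A, ← hs]
        · intro c _ hc
          have : y ∉ A c := fun hyc => hc (Subtype.ext hyc.2.symm)
          simp [this]
        · simp
      · have : ∀ c, y ∉ A c := fun c hyc => hy hyc.1
        simp [hg, hy, this, hF0]
    have e1 := hF id rfl
    have e2 := hF (fun u => 1 - negExp u) (by simp [negExp_zero])
    simp only [id] at e1
    simp_rw [e2]
    simp_rw [e1]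
    rw [h.laplace_of_finite _ A hAm hAv hAd, lintegral_finsetSum
      (f := fun c y => (1 - negExp c.1) * (A c).indicator 1 y) _
      fun c _ => measurable_const.mul (measurable_one.indicator (hAm c))]
    congr 2
    refine Finset.sum_congr rfl fun c _ => ?_
    rw [lintegral_const_mul _ (measurable_one.indicator (hAm c)), lintegral_indicator_one (hAm c),
      mul_comm]
  have hlim : ∀ y, Filter.Tendsto (fun n => g n y) Filter.atTop (nhds (f y)) := fun y => by
    rw [← hsup y]; exact tendsto_atTop_iSup fun m n hmn => hmono hmn y
  have hL : Filter.Tendsto (fun n => ∫⁻ ω, negExp (∑' i, g n (x i ω)) ∂P) Filter.atTop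
      (nhds (∫⁻ ω, negExp (∑' i, f (x i ω)) ∂P)) := by
    refine tendsto_lintegral_of_dominated_convergence (fun _ => 1) (fun n => ?_) (fun n => ?_)
      (by simp) ?_
    · exact measurable_negExp.comp (Measurable.tsum fun i => (hgm n).comp (h.measurable i))
    · exact Filter.Eventually.of_forall fun ω => negExp_le_one _
    · refine Filter.Eventually.of_forall fun ω => (continuous_negExp.tendsto _).comp ?_
      have : ∑' i, f (x i ω) = ⨆ n, ∑' i, g n (x i ω) := by
        rw [← ENNReal.tsum_iSup_of_monotone (f := fun n i => g n (x i ω))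
          (fun m n hmn i => hmono hmn _)]
        simp_rw [hsup]
      rw [this]
      exact tendsto_atTop_iSup fun m n hmn => ENNReal.tsum_le_tsum fun i => hmono hmn _
  have hR : Filter.Tendsto (fun n => negExp (ENNReal.ofReal lam * ∫⁻ y, (1 - negExp (g n y))))
      Filter.atTop (nhds (negExp (ENNReal.ofReal lam * ∫⁻ y, (1 - negExp (f y))))) := by
    refine (continuous_negExp.tendsto _).comp (ENNReal.Tendsto.const_mul ?_
      (Or.inr ENNReal.ofReal_ne_top))
    refine lintegral_tendsto_of_tendsto_of_monotone (fun n => ?_) ?_ ?_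
    · exact (measurable_const.sub (measurable_negExp.comp (hgm n))).aemeasurable
    · exact Filter.Eventually.of_forall fun y m n hmn =>
        tsub_le_tsub_left (antitone_negExp (hmono hmn y)) _
    · refine Filter.Eventually.of_forall fun y => ?_
      exact ENNReal.Tendsto.sub tendsto_const_nhds ((continuous_negExp.tendsto _).comp (hlim y))
        (Or.inl ENNReal.one_ne_top)
  simp_rw [hfin] at hL
  exact tendsto_nhds_unique hL hR

/-- The count has finite mean, and each point in `A` contributes $1$ to it. -/
theorem IsHomogeneousPPP.ae_finite_mem [IsProbabilityMeasure P] (h : IsHomogeneousPPP P lam x)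
    {A : Set Plane} (hA : MeasurableSet A) (hA' : volume A ≠ ∞) :
    ∀ᵐ ω ∂P, {i | x i ω ∈ A}.Finite := by
  have : ∀ᵐ ω ∂P, pointCount x A ω < ∞ := by
    refine ae_lt_top (h.measurable_pointCount hA) ?_
    rw [h.lintegral_pointCount hA hA']
    exact ENNReal.mul_ne_top ENNReal.ofReal_ne_top hA'
  filter_upwards [this] with ω hω
  have := ENNReal.finite_const_le_of_tsum_ne_top hω.ne (one_ne_zero)
  refine this.subset fun i hi => ?_
  simp only [mem_ofPred_eq] at hi ⊢
  simp [hi]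

end PPP

/-! ### Radial integrals over the plane -/

theorem lintegral_fun_norm_plane {f : ℝ → ℝ≥0∞} (hf : Measurable f) :
    ∫⁻ y : Plane, f ‖y‖ =
      ENNReal.ofReal (2 * Real.pi) * ∫⁻ r in Ioi (0 : ℝ), ENNReal.ofReal r * f r := by
  have hd : Module.finrank ℝ Plane = 2 := by simp
  calc ∫⁻ y : Plane, f ‖y‖
    _ = ∫⁻ y : ({(0)}ᶜ : Set Plane), f ‖y.1‖ ∂(Measure.comap Subtype.val volume) := by
      rw [lintegral_subtype_comap (measurableSet_singleton _).compl fun y => f ‖y‖,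
        restrict_compl_singleton]
    _ = ∫⁻ z, f z.2 ∂((volume : Measure Plane).toSphere.prod (.volumeIoiPow 1)) := by
      have := (volume : Measure Plane).measurePreserving_homeomorphUnitSphereProd.lintegral_comp_emb
        (Homeomorph.measurableEmbedding _) (f ∘ Subtype.val ∘ Prod.snd)
      simpa [hd] using this
    _ = (volume : Measure Plane).toSphere univ *
        ∫⁻ r : Ioi (0 : ℝ), f r ∂(Measure.volumeIoiPow 1) := by
      rw [lintegral_prod _ (by fun_prop)]; simp only [lintegral_const, mul_comm]
    _ = _ := by
      congr 1
      · rw [Measure.toSphere_apply_univ, hd, EuclideanSpace.volume_ball_fin_two]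
        simp [ENNReal.ofReal_mul]
      · rw [Measure.volumeIoiPow, lintegral_withDensity_eq_lintegral_mul _ (by fun_prop)
          (by fun_prop)]
        have := lintegral_subtype_comap (μ := volume) (measurableSet_Ioi (a := (0 : ℝ)))
          (fun r => ENNReal.ofReal r * f r)
        simpa using this

theorem lintegral_rpow_mul_exp_neg_mul_rpow {p q b : ℝ} (hp : 0 < p) (hq : -1 < q) (hb : 0 < b) :
    ∫⁻ x in Ioi (0 : ℝ), ENNReal.ofReal (x ^ q * Real.exp (-b * x ^ p)) =
      ENNReal.ofReal (b ^ (-(q + 1) / p) * (1 / p) * Real.Gamma ((q + 1) / p)) := by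
  rw [← integral_rpow_mul_exp_neg_mul_rpow hp hq hb, ofReal_integral_eq_lintegral_ofReal
    (integrableOn_rpow_mul_exp_neg_mul_rpow hq hp hb)]
  filter_upwards [ae_restrict_mem measurableSet_Ioi] with x hx
  have : 0 < x := hx
  simp only [Pi.zero_apply]; positivity

theorem lintegral_exp_neg_mul_Ioi {b : ℝ} (hb : 0 < b) :
    ∫⁻ x in Ioi (0 : ℝ), ENNReal.ofReal (Real.exp (-b * x)) = ENNReal.ofReal (1 / b) := by
  have := lintegral_rpow_mul_exp_neg_mul_rpow one_pos (q := 0) (by norm_num) hb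
  simpa [Real.rpow_neg_one] using this

/-- The beta integral that yields the cosecant, by way of `Γ(s) Γ(1 - s) = π / sin (π s)`. -/
theorem lintegral_mul_div_rpow_add {a c : ℝ} (ha : 2 < a) (hc : 0 < c) :
    ∫⁻ r in Ioi (0 : ℝ), ENNReal.ofReal (r * (c / (r ^ a + c))) =
      ENNReal.ofReal (c ^ (2 / a) * (Real.pi / a) * (1 / Real.sin (2 * Real.pi / a))) := by
  have ha0 : 0 < a := by linarith
  have hδ : 2 / a < 1 := by rw [div_lt_one ha0]; exact ha
  -- Writing $1/(r^a+c)$ as $\int_0^\infty e^{-(r^a+c)v}\,dv$ and exchanging the integrals leaves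
  -- one Gamma integral in $r$ and one in $v$.
  have h1 : ∀ r ∈ Ioi (0 : ℝ), ENNReal.ofReal (r * (c / (r ^ a + c))) =
      ∫⁻ v in Ioi (0 : ℝ), ENNReal.ofReal (r * c * Real.exp (-(r ^ a + c) * v)) := fun r hr => by
    have hr0 : 0 < r := hr
    have hb : 0 < r ^ a + c := by positivity
    simp_rw [ENNReal.ofReal_mul (mul_pos hr0 hc).le]
    rw [lintegral_const_mul _ (by fun_prop), lintegral_exp_neg_mul_Ioi hb,
      ← ENNReal.ofReal_mul (by positivity)]
    congr 1; ring
  rw [setLIntegral_congr_fun measurableSet_Ioi h1, lintegral_lintegral_swap (by fun_prop)]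
  have h2 : ∀ v ∈ Ioi (0 : ℝ),
      ∫⁻ r in Ioi (0 : ℝ), ENNReal.ofReal (r * c * Real.exp (-(r ^ a + c) * v)) =
      ENNReal.ofReal (c * (1 / a) * Real.Gamma (2 / a)) *
        ENNReal.ofReal (v ^ (-(2 / a)) * Real.exp (-c * v ^ (1 : ℝ))) := fun v hv => by
    have hv0 : 0 < v := hv
    have hG : 0 < Real.Gamma (2 / a) := Real.Gamma_pos_of_pos (by positivity)
    have e : ∀ r : ℝ, ENNReal.ofReal (r * c * Real.exp (-(r ^ a + c) * v)) =
        ENNReal.ofReal (c * Real.exp (-c * v)) *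
          ENNReal.ofReal (r ^ (1 : ℝ) * Real.exp (-v * r ^ a)) := fun r => by
      rw [← ENNReal.ofReal_mul (by positivity), Real.rpow_one]
      congr 1
      rw [show -(r ^ a + c) * v = -c * v + -v * r ^ a by ring, Real.exp_add]; ring
    simp_rw [e]
    rw [lintegral_const_mul _ (by fun_prop),
      lintegral_rpow_mul_exp_neg_mul_rpow ha0 (by norm_num) hv0,
      ← ENNReal.ofReal_mul (by positivity), ← ENNReal.ofReal_mul (by positivity), Real.rpow_one]
    congr 1
    rw [show (1 : ℝ) + 1 = 2 by norm_num, neg_div]; ring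
  rw [setLIntegral_congr_fun measurableSet_Ioi h2, lintegral_const_mul _ (by fun_prop),
    lintegral_rpow_mul_exp_neg_mul_rpow one_pos (by linarith) hc]
  have hG : 0 < Real.Gamma (2 / a) := Real.Gamma_pos_of_pos (by positivity)
  rw [← ENNReal.ofReal_mul (by positivity)]
  congr 1
  have hΓ := Real.Gamma_mul_Gamma_one_sub (2 / a)
  rw [show -(-(2 / a) + 1) / 1 = 2 / a - 1 by ring, show (-(2 / a) + 1) / 1 = 1 - 2 / a by ring,
    Real.rpow_sub_one hc.ne']
  calc _ = c ^ (2 / a) * (1 / a) * (Real.Gamma (2 / a) * Real.Gamma (1 - 2 / a)) := by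
        field_simp
    _ = _ := by rw [hΓ, show Real.pi * (2 / a) = 2 * Real.pi / a by ring]; ring

theorem lintegral_plane_ratio {a c : ℝ} (ha : 2 < a) (hc : 0 < c) :
    ∫⁻ y : Plane, ENNReal.ofReal (c * ‖y‖ ^ (-a) / (1 + c * ‖y‖ ^ (-a))) =
      ENNReal.ofReal (2 * Real.pi ^ 2 / a * (1 / Real.sin (2 * Real.pi / a)) * c ^ (2 / a)) := by
  rw [lintegral_fun_norm_plane (f := fun r => ENNReal.ofReal (c * r ^ (-a) / (1 + c * r ^ (-a))))
    (by fun_prop)]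
  have h : ∀ r ∈ Ioi (0 : ℝ), ENNReal.ofReal r *
      ENNReal.ofReal (c * r ^ (-a) / (1 + c * r ^ (-a))) =
      ENNReal.ofReal (r * (c / (r ^ a + c))) := fun r hr => by
    have hr0 : 0 < r := hr
    rw [← ENNReal.ofReal_mul hr0.le, Real.rpow_neg hr0.le]
    congr 1
    have : 0 < r ^ a := by positivity
    field_simp
  rw [setLIntegral_congr_fun measurableSet_Ioi h, lintegral_mul_div_rpow_add ha hc,
    ← ENNReal.ofReal_mul (by positivity)]
  congr 1
  ring

theorem lintegral_plane_rpow_compl_closedBall {a c R : ℝ} (ha : 2 < a) (hc : 0 < c) (hR : 0 < R) :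
    ∫⁻ y : Plane, (Metric.closedBall (0 : Plane) R)ᶜ.indicator
      (fun y => ENNReal.ofReal (c * ‖y‖ ^ (-a))) y =
      ENNReal.ofReal (2 * Real.pi / (a - 2) * c * R ^ (2 - a)) := by
  have h0 : ∀ y : Plane, (Metric.closedBall (0 : Plane) R)ᶜ.indicator
      (fun y => ENNReal.ofReal (c * ‖y‖ ^ (-a))) y =
      (Ioi R).indicator (fun r => ENNReal.ofReal (c * r ^ (-a))) ‖y‖ := fun y => by
    by_cases h : ‖y‖ ≤ R
    · simp [h]
    · simp [h, not_le.1 h]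
  simp_rw [h0]
  rw [lintegral_fun_norm_plane (Measurable.indicator (by fun_prop) measurableSet_Ioi)]
  have h1 : ∀ r ∈ Ioi (0 : ℝ), ENNReal.ofReal r *
      (Ioi R).indicator (fun r => ENNReal.ofReal (c * r ^ (-a))) r =
      (Ioi R).indicator (fun r => ENNReal.ofReal (c * r ^ (1 - a))) r := fun r hr => by
    have hr0 : 0 < r := hr
    by_cases h : r ∈ Ioi R
    · rw [indicator_of_mem h, indicator_of_mem h, ← ENNReal.ofReal_mul hr0.le,
        sub_eq_add_neg, Real.rpow_add hr0, Real.rpow_one]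
      congr 1; ring
    · simp [h]
  rw [setLIntegral_congr_fun measurableSet_Ioi h1, setLIntegral_indicator measurableSet_Ioi,
    Ioi_inter_Ioi, max_eq_left hR.le, ← ofReal_integral_eq_lintegral_ofReal
      ((integrableOn_Ioi_rpow_of_lt (by linarith) hR).const_mul c), integral_const_mul,
    integral_Ioi_rpow_of_lt (by linarith) hR, ← ENNReal.ofReal_mul (by positivity)]
  · congr 1
    rw [show 1 - a + 1 = -(a - 2) by ring, show 2 - a = -(a - 2) by ring]
    have : a - 2 ≠ 0 := by linarith
    field_simp
  · filter_upwards [ae_restrict_mem measurableSet_Ioi] with r hr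
    have : 0 < r := hR.trans hr
    simp only [Pi.zero_apply]; positivity

/-! ### Exponential fading -/

theorem measurable_gammaPDF (a r : ℝ) : Measurable (gammaPDF a r) :=
  (measurable_gammaPDFReal a r).ennreal_ofReal

theorem lintegral_expMeasure (r : ℝ) {f : ℝ → ℝ≥0∞} (hf : Measurable f) :
    ∫⁻ y, f y ∂(expMeasure r) = ∫⁻ y, gammaPDF 1 r y * f y := by
  rw [expMeasure, gammaMeasure, lintegral_withDensity_eq_lintegral_mul _
    (measurable_gammaPDF 1 r) hf]
  rfl

theorem lintegral_negExp_expMeasure {r a : ℝ} (hr : 0 < r) (ha : 0 ≤ a) :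
    ∫⁻ y, negExp (ENNReal.ofReal (a * y)) ∂(expMeasure r) = ENNReal.ofReal (r / (r + a)) := by
  have hra : 0 < r + a := by linarith
  rw [lintegral_expMeasure r (f := fun y => negExp (ENNReal.ofReal (a * y)))
    (measurable_negExp.comp (by fun_prop))]
  -- Tilting the exponential density of rate $r$ by $e^{-ay}$ gives a multiple of the density of
  -- rate $r+a$.
  have h : ∀ y : ℝ, gammaPDF 1 r y * negExp (ENNReal.ofReal (a * y)) =
      ENNReal.ofReal (r / (r + a)) * gammaPDF 1 (r + a) y := fun y => by
    rcases lt_or_ge y 0 with hy | hy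
    · simp [gammaPDF_of_neg hy]
    · rw [gammaPDF_of_nonneg hy, gammaPDF_of_nonneg hy, negExp_ofReal (by positivity),
        ← ENNReal.ofReal_mul (by simp; positivity), ← ENNReal.ofReal_mul (by positivity)]
      congr 1
      simp only [Real.Gamma_one, Real.rpow_one, sub_self, Real.rpow_zero, div_one, mul_one]
      rw [show -((r + a) * y) = -(r * y) + -(a * y) by ring, Real.exp_add]
      field_simp
  simp_rw [h]
  rw [lintegral_const_mul _ (measurable_gammaPDF 1 _),
    lintegral_gammaPDF_eq_one one_pos hra, mul_one]

theorem lintegral_ofReal_expMeasure {r : ℝ} (hr : 0 < r) :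
    ∫⁻ y, ENNReal.ofReal y ∂(expMeasure r) = ENNReal.ofReal (1 / r) := by
  rw [lintegral_expMeasure r (by fun_prop)]
  -- Size biasing the exponential density gives a multiple of the Gamma density of shape $2$.
  have h : ∀ y : ℝ, gammaPDF 1 r y * ENNReal.ofReal y =
      ENNReal.ofReal (1 / r) * gammaPDF 2 r y := fun y => by
    rcases lt_or_ge y 0 with hy | hy
    · simp [gammaPDF_of_neg hy]
    · rw [gammaPDF_of_nonneg hy, gammaPDF_of_nonneg hy,
        ← ENNReal.ofReal_mul (by simp; positivity), ← ENNReal.ofReal_mul (by positivity)]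
      congr 1
      simp only [Real.Gamma_one, Real.Gamma_two, Real.rpow_one, sub_self, Real.rpow_zero, div_one,
        mul_one, Real.rpow_ofNat, show (2 : ℝ) - 1 = 1 by norm_num]
      field_simp
  simp_rw [h]
  rw [lintegral_const_mul _ (measurable_gammaPDF 2 _),
    lintegral_gammaPDF_eq_one two_pos hr, mul_one]

/-! ### Laplace transform of the total power, mean interference, cluster power -/

namespace HetNet

theorem omegaT_pos {n : ℕ} (N : HetNet n) (k : Fin (n + 1)) : 0 < N.omegaT k := by
  have hα := N.two_lt_alpha k
  have := N.p_pos k; have := N.mu_pos k; have := N.lam_pos k; have hpi := Real.pi_pos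
  have : 0 < Real.sin (2 * Real.pi / N.alpha k) := by
    refine Real.sin_pos_of_pos_of_lt_pi (by positivity) ?_
    rw [div_lt_iff₀ (by linarith)]
    nlinarith
  unfold HetNet.omegaT
  positivity

section Received

variable {Ω : Type*} {n : ℕ} {N : HetNet n} {x : Fin (n + 1) → ℕ → Ω → Plane}
  {Psi : Fin (n + 1) → ℕ → Ω → ℝ}

theorem received_eq (k : Fin (n + 1)) (i : ℕ) (ω : Ω) :
    N.received x Psi k i ω =
      ENNReal.ofReal (N.p k * ‖x k i ω‖ ^ (-N.alpha k)) * ENNReal.ofReal (Psi k i ω) := by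
  have := N.p_pos k
  rw [HetNet.received, ← ENNReal.ofReal_mul (by positivity)]
  congr 1; ring

/-- The radii only divide the stations between the two sums; hence the Laplace transform of the
total does not depend on them. -/
theorem signal_add_interference (R : Fin (n + 1) → ℝ) (ω : Ω) :
    N.signal x Psi R ω + N.interference x Psi R ω = ∑ k, ∑' i, N.received x Psi k i ω := by
  rw [HetNet.signal, HetNet.interference, ← Finset.sum_add_distrib]
  refine Finset.sum_congr rfl fun k _ => ?_
  rw [← ENNReal.tsum_add]
  congr with i
  split_ifs <;> simp

end Received

end HetNet

namespace IsNetworkModel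

variable {Ω : Type*} [MeasurableSpace Ω] {n : ℕ} {N : HetNet n} {P : Measure Ω}
  {x : Fin (n + 1) → ℕ → Ω → Plane} {Psi : Fin (n + 1) → ℕ → Ω → ℝ}

theorem measurable_location (h : IsNetworkModel N P x Psi) (k : Fin (n + 1)) (i : ℕ) :
    Measurable (x k i) := (h.ppp k).measurable i

theorem lintegral_fading (h : IsNetworkModel N P x Psi) (k : Fin (n + 1)) (i : ℕ) :
    ∫⁻ ω, ENNReal.ofReal (Psi k i ω) ∂P = ENNReal.ofReal (N.mu k) := by
  have hμ := N.mu_pos k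
  rw [← lintegral_map ENNReal.measurable_ofReal (h.fading_measurable k i), h.fading_law,
    lintegral_ofReal_expMeasure (by positivity), one_div_one_div]

/-- The value is $1/(1+\mu a)$. It is written as an exponential so that the product over all
stations becomes the exponential of a sum over the points, to which the Laplace functional applies.
-/
theorem lintegral_negExp_fading (h : IsNetworkModel N P x Psi) (k : Fin (n + 1)) (i : ℕ) {a : ℝ}
    (ha : 0 ≤ a) :
    ∫⁻ ω, negExp (ENNReal.ofReal (a * Psi k i ω)) ∂P =
      negExp (ENNReal.ofReal (Real.log (1 + N.mu k * a))) := by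
  have hμ := N.mu_pos k
  have h1 : 1 ≤ 1 + N.mu k * a := by nlinarith [mul_nonneg hμ.le ha]
  rw [← lintegral_map (f := fun y => negExp (ENNReal.ofReal (a * y)))
    (measurable_negExp.comp (by fun_prop)) (h.fading_measurable k i), h.fading_law,
    lintegral_negExp_expMeasure (by positivity) ha, negExp_ofReal (Real.log_nonneg h1),
    Real.exp_neg, Real.exp_log (by linarith)]
  congr 1
  field_simp

theorem lintegral_negExp_sum_fading [IsProbabilityMeasure P] (h : IsNetworkModel N P x Psi)
    {a : Fin (n + 1) → ℕ → ℝ} (ha : ∀ k i, 0 ≤ a k i) :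
    ∫⁻ ω, negExp (∑ k, ∑' i, ENNReal.ofReal (a k i * Psi k i ω)) ∂P =
      negExp (∑ k, ∑' i, ENNReal.ofReal (Real.log (1 + N.mu k * a k i))) := by
  have hm : ∀ k i, Measurable fun ω => ENNReal.ofReal (a k i * Psi k i ω) := fun k i =>
    ((h.fading_measurable k i).const_mul _).ennreal_ofReal
  have hfin : ∀ m : ℕ,
      ∫⁻ ω, negExp (∑ k, ∑ i ∈ Finset.range m, ENNReal.ofReal (a k i * Psi k i ω)) ∂P =
      negExp (∑ k, ∑ i ∈ Finset.range m, ENNReal.ofReal (Real.log (1 + N.mu k * a k i))) :=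
    fun m => by
    simp_rw [← Finset.sum_product', negExp_sum]
    rw [lintegral_prod_eq_prod_lintegral_of_indepFun _
      (fun (ki : Fin (n + 1) × ℕ) ω => negExp (ENNReal.ofReal (a ki.1 ki.2 * Psi ki.1 ki.2 ω)))
      (h.fading_indep.comp (fun ki y => negExp (ENNReal.ofReal (a ki.1 ki.2 * y)))
        (fun ki => measurable_negExp.comp (by fun_prop)))
      (fun ki => measurable_negExp.comp (hm _ _))]
    exact Finset.prod_congr rfl fun ki _ => h.lintegral_negExp_fading _ _ (ha _ _)
  have hlim : ∀ f : Fin (n + 1) → ℕ → ℝ≥0∞, Filter.Tendsto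
      (fun m => negExp (∑ k, ∑ i ∈ Finset.range m, f k i)) Filter.atTop
      (nhds (negExp (∑ k, ∑' i, f k i))) := fun f =>
    (continuous_negExp.tendsto _).comp
      (tendsto_finsetSum _ fun k _ => ENNReal.tendsto_nat_tsum _)
  have hL := tendsto_lintegral_of_dominated_convergence (μ := P) (fun _ => 1)
    (F := fun m ω => negExp (∑ k, ∑ i ∈ Finset.range m, ENNReal.ofReal (a k i * Psi k i ω)))
    (f := fun ω => negExp (∑ k, ∑' i, ENNReal.ofReal (a k i * Psi k i ω)))
    (fun m => measurable_negExp.comp (Finset.measurable_sum _ fun k _ =>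
      Finset.measurable_sum _ fun i _ => hm k i))
    (fun m => Filter.Eventually.of_forall fun ω => negExp_le_one _) (by simp)
    (Filter.Eventually.of_forall fun ω => hlim _)
  simp_rw [hfin] at hL
  exact tendsto_nhds_unique hL (hlim _)

/-- The Laplace transform of a shot noise with exponential fading, as a product over the tiers. -/
theorem lintegral_negExp_shotNoise [IsProbabilityMeasure P] (h : IsNetworkModel N P x Psi)
    {w : Fin (n + 1) → Plane → ℝ} (hw : ∀ k, Measurable (w k)) (hw0 : ∀ k y, 0 ≤ w k y) :
    ∫⁻ ω, negExp (∑ k, ∑' i, ENNReal.ofReal (w k (x k i ω) * Psi k i ω)) ∂P =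
      negExp (∑ k, ENNReal.ofReal (N.lam k) *
        ∫⁻ y, ENNReal.ofReal (N.mu k * w k y / (1 + N.mu k * w k y))) := by
  set X : Ω → Fin (n + 1) → ℕ → Plane := fun ω k i => x k i ω with hX
  set F : Ω → Fin (n + 1) → ℕ → ℝ := fun ω k i => Psi k i ω with hF
  have hXm : Measurable X := measurable_pi_iff.2 fun k => measurable_pi_iff.2 fun i =>
    h.measurable_location k i
  have hFm : Measurable F := measurable_pi_iff.2 fun k => measurable_pi_iff.2 fun i =>
    h.fading_measurable k i
  set G : (Fin (n + 1) → ℕ → Plane) × (Fin (n + 1) → ℕ → ℝ) → ℝ≥0∞ := fun z =>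
    negExp (∑ k, ∑' i, ENNReal.ofReal (w k (z.1 k i) * z.2 k i)) with hG
  have hGm : Measurable G := by
    refine measurable_negExp.comp (Finset.measurable_sum _ fun k _ => Measurable.tsum fun i => ?_)
    have := hw k
    fun_prop
  have hpos : ∀ k y, 0 ≤ N.mu k * w k y := fun k y => mul_nonneg (N.mu_pos k).le (hw0 k y)
  have hgm : ∀ k, Measurable fun y => ENNReal.ofReal (Real.log (1 + N.mu k * w k y)) := fun k => by
    have := hw k
    fun_prop
  have hprod := (indepFun_iff_map_prod_eq_prod_map_map hXm.aemeasurable hFm.aemeasurable).1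
    h.locations_indep_fading
  have hpF : IsProbabilityMeasure (P.map F) := Measure.isProbabilityMeasure_map hFm.aemeasurable
  -- The fading is integrated out first, for fixed locations. The result is a product over the
  -- tiers, whose independence then applies.
  have hinner : ∀ z, ∫⁻ f, G (z, f) ∂(P.map F) =
      ∏ k, negExp (∑' i, ENNReal.ofReal (Real.log (1 + N.mu k * w k (z k i)))) := fun z => by
    rw [lintegral_map (by fun_prop) hFm, ← negExp_sum]
    exact h.lintegral_negExp_sum_fading fun k i => hw0 k (z k i)
  have hHm : ∀ k, Measurable fun z : ℕ → Plane =>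
      negExp (∑' i, ENNReal.ofReal (Real.log (1 + N.mu k * w k (z i)))) := fun k =>
    measurable_negExp.comp (Measurable.tsum fun i => (hgm k).comp (measurable_pi_apply i))
  calc ∫⁻ ω, negExp (∑ k, ∑' i, ENNReal.ofReal (w k (x k i ω) * Psi k i ω)) ∂P
    _ = ∫⁻ ω, G (X ω, F ω) ∂P := rfl
    _ = ∫⁻ z, ∏ k, negExp (∑' i, ENNReal.ofReal (Real.log (1 + N.mu k * w k (z k i))))
          ∂(P.map X) := by
      rw [← lintegral_map hGm (hXm.prodMk hFm), hprod, lintegral_prod _ hGm.aemeasurable]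
      simp_rw [hinner]
    _ = ∫⁻ ω, ∏ k, negExp (∑' i, ENNReal.ofReal (Real.log (1 + N.mu k * w k (x k i ω)))) ∂P :=
      lintegral_map (Finset.measurable_prod _ fun k _ => (hHm k).comp (measurable_pi_apply k)) hXm
    _ = ∏ k, ∫⁻ ω, negExp (∑' i, ENNReal.ofReal (Real.log (1 + N.mu k * w k (x k i ω)))) ∂P :=
      lintegral_prod_eq_prod_lintegral_of_indepFun _
        (fun k ω => negExp (∑' i, ENNReal.ofReal (Real.log (1 + N.mu k * w k (x k i ω)))))
        (h.indep_tiers.comp _ hHm)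
        (fun k => (hHm k).comp (measurable_pi_iff.2 fun i => h.measurable_location k i))
    _ = _ := by
      rw [negExp_sum]
      refine Finset.prod_congr rfl fun k _ => ?_
      rw [(h.ppp k).laplace (hgm k)]
      congr 2
      refine lintegral_congr fun y => ?_
      -- With $u=\mu_kw_k(y)$, the integrand of the Laplace functional is $1-1/(1+u)=u/(1+u)$.
      have h1 : 0 < 1 + N.mu k * w k y := by linarith [hpos k y]
      rw [negExp_ofReal (Real.log_nonneg (by linarith [hpos k y])), Real.exp_neg,
        Real.exp_log h1, ← ENNReal.ofReal_one, ← ENNReal.ofReal_sub _ (by positivity)]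
      congr 1
      field_simp
      ring

/-- Campbell's formula for the mean of a shot noise. -/
theorem lintegral_shotNoise (h : IsNetworkModel N P x Psi) (k : Fin (n + 1))
    {g : Plane → ℝ≥0∞} (hg : Measurable g) :
    ∫⁻ ω, ∑' i, g (x k i ω) * ENNReal.ofReal (Psi k i ω) ∂P =
      ENNReal.ofReal (N.lam k) * (∫⁻ y, g y) * ENNReal.ofReal (N.mu k) := by
  have hm : ∀ i, Measurable fun ω => g (x k i ω) := fun i => hg.comp (h.measurable_location k i)
  have hm' : ∀ i, Measurable fun ω => ENNReal.ofReal (Psi k i ω) := fun i =>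
    (h.fading_measurable k i).ennreal_ofReal
  rw [lintegral_tsum (f := fun i ω => g (x k i ω) * ENNReal.ofReal (Psi k i ω)) fun i =>
      ((hm i).mul (hm' i)).aemeasurable,
    ← (h.ppp k).lintegral_tsum_comp hg, ← ENNReal.tsum_mul_right]
  congr with i
  rw [← h.lintegral_fading k i]
  refine lintegral_mul_eq_lintegral_mul_lintegral_of_indepFun (hm i) (hm' i) ?_
  exact h.locations_indep_fading.comp (φ := fun z => g (z k i))
    (ψ := fun f => ENNReal.ofReal (f k i)) (by fun_prop) (by fun_prop)

theorem measurable_received (h : IsNetworkModel N P x Psi) (k : Fin (n + 1)) (i : ℕ) :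
    Measurable (N.received x Psi k i) := by
  have h1 := h.measurable_location k i
  have h2 := h.fading_measurable k i
  unfold HetNet.received
  fun_prop

theorem measurableSet_location (h : IsNetworkModel N P x Psi) (k : Fin (n + 1)) (i : ℕ) (r : ℝ) :
    MeasurableSet {ω | x k i ω ∈ Metric.closedBall (0 : Plane) r} :=
  h.measurable_location k i Metric.isClosed_closedBall.measurableSet

theorem measurable_signal (h : IsNetworkModel N P x Psi) (R : Fin (n + 1) → ℝ) :
    Measurable (N.signal x Psi R) :=
  Finset.measurable_sum _ fun k _ => Measurable.tsum fun i =>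
    Measurable.ite (h.measurableSet_location k i _) (h.measurable_received k i) measurable_const

theorem measurable_interference (h : IsNetworkModel N P x Psi) (R : Fin (n + 1) → ℝ) :
    Measurable (N.interference x Psi R) :=
  Finset.measurable_sum _ fun k _ => Measurable.tsum fun i =>
    Measurable.ite (h.measurableSet_location k i _) measurable_const (h.measurable_received k i)

theorem meanInterference_eq (h : IsNetworkModel N P x Psi) {R : Fin (n + 1) → ℝ}
    (hR : ∀ k, 0 < R k) :
    N.meanInterference x Psi P R = ENNReal.ofReal (∑ k, 2 * Real.pi / (N.alpha k - 2) * N.p k *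
      N.mu k * N.lam k * R k ^ (2 - N.alpha k)) := by
  have hp := N.p_pos
  have hμ := N.mu_pos
  have hl := N.lam_pos
  have hα : ∀ k, 0 < N.alpha k - 2 := fun k => by linarith [N.two_lt_alpha k]
  set g : Fin (n + 1) → Plane → ℝ≥0∞ := fun k => (Metric.closedBall (0 : Plane) (R k))ᶜ.indicator
    (fun y => ENNReal.ofReal (N.p k * ‖y‖ ^ (-N.alpha k))) with hg
  have hgm : ∀ k, Measurable (g k) := fun k =>
    Measurable.indicator (by fun_prop) Metric.isClosed_closedBall.measurableSet.compl
  have h1 : ∀ ω, N.interference x Psi R ω =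
      ∑ k, ∑' i, g k (x k i ω) * ENNReal.ofReal (Psi k i ω) := fun ω => by
    rw [HetNet.interference]
    refine Finset.sum_congr rfl fun k _ => ?_
    congr with i
    rw [HetNet.received_eq]
    by_cases hx : x k i ω ∈ Metric.closedBall (0 : Plane) (R k)
    · rw [if_pos hx]
      simp only [hg]
      rw [indicator_of_notMem (not_not_intro hx), zero_mul]
    · rw [if_neg hx]
      simp only [hg]
      rw [indicator_of_mem (mem_compl hx)]
  rw [HetNet.meanInterference]
  simp_rw [h1]
  rw [lintegral_finsetSum (f := fun k ω => ∑' i, g k (x k i ω) * ENNReal.ofReal (Psi k i ω)) _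
    fun k _ => Measurable.tsum fun i => ((hgm k).comp (h.measurable_location k i)).mul
      (h.fading_measurable k i).ennreal_ofReal, ENNReal.ofReal_sum_of_nonneg fun k _ => by
        have := hα k; have := hp k; have := hμ k; have := hl k; have := hR k
        positivity]
  refine Finset.sum_congr rfl fun k _ => ?_
  rw [h.lintegral_shotNoise k (hgm k),
    lintegral_plane_rpow_compl_closedBall (N.two_lt_alpha k) (hp k) (hR k)]
  have := hα k; have := hp k; have := hμ k; have := hl k; have := hR k
  rw [← ENNReal.ofReal_mul (by positivity), ← ENNReal.ofReal_mul (by positivity)]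
  congr 1; ring

/-- Almost surely each disc contains finitely many stations. The mean is of no help:
$\|y\|^{-\alpha}$ is not integrable at the origin for $\alpha>2$. -/
theorem ae_signal_ne_top [IsProbabilityMeasure P] (h : IsNetworkModel N P x Psi)
    (R : Fin (n + 1) → ℝ) : ∀ᵐ ω ∂P, N.signal x Psi R ω ≠ ∞ := by
  have hA := ae_all_iff.2 fun k => (h.ppp k).ae_finite_mem
    (Metric.isClosed_closedBall.measurableSet : MeasurableSet (Metric.closedBall (0 : Plane) (R k)))
    (isCompact_closedBall (0 : Plane) (R k)).measure_lt_top.ne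
  filter_upwards [hA] with ω hω
  rw [HetNet.signal]
  refine ENNReal.sum_ne_top.2 fun k _ => ?_
  rw [tsum_eq_sum (s := (hω k).toFinset) fun i hi => if_neg (by simpa using hi)]
  refine ENNReal.sum_ne_top.2 fun i _ => ?_
  split_ifs
  · exact ENNReal.ofReal_ne_top
  · exact ENNReal.zero_ne_top

theorem ae_interference_ne_top (h : IsNetworkModel N P x Psi)
    {R : Fin (n + 1) → ℝ} (hR : ∀ k, 0 < R k) : ∀ᵐ ω ∂P, N.interference x Psi R ω ≠ ∞ := by
  filter_upwards [ae_lt_top (h.measurable_interference R)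
    ((h.meanInterference_eq hR).trans_ne ENNReal.ofReal_ne_top)] with ω hω
  exact hω.ne

theorem lintegral_negExp_total [IsProbabilityMeasure P] (h : IsNetworkModel N P x Psi)
    (R : Fin (n + 1) → ℝ) {t : ℝ} (ht : 0 < t) :
    ∫⁻ ω, negExp (ENNReal.ofReal t * (N.signal x Psi R ω + N.interference x Psi R ω)) ∂P =
      ENNReal.ofReal (Real.exp (-∑ k, N.omegaT k * t ^ (2 / N.alpha k))) := by
  have hp := N.p_pos
  have h1 : ∀ ω, ENNReal.ofReal t * (N.signal x Psi R ω + N.interference x Psi R ω) =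
      ∑ k, ∑' i, ENNReal.ofReal (t * N.p k * ‖x k i ω‖ ^ (-N.alpha k) * Psi k i ω) := fun ω => by
    rw [HetNet.signal_add_interference, Finset.mul_sum]
    refine Finset.sum_congr rfl fun k _ => ?_
    rw [← ENNReal.tsum_mul_left]
    congr with i
    rw [HetNet.received, ← ENNReal.ofReal_mul ht.le]
    congr 1; ring
  simp_rw [h1]
  rw [h.lintegral_negExp_shotNoise (w := fun k y => t * N.p k * ‖y‖ ^ (-N.alpha k))
    (fun k => by fun_prop) (fun k y => by have := hp k; positivity), ← negExp_ofReal
    (Finset.sum_nonneg fun k _ => mul_nonneg (N.omegaT_pos k).le (by positivity)),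
    ENNReal.ofReal_sum_of_nonneg fun k _ => mul_nonneg (N.omegaT_pos k).le (by positivity)]
  congr 1
  refine Finset.sum_congr rfl fun k _ => ?_
  have := hp k; have hμ := N.mu_pos k; have hl := N.lam_pos k
  have hc : 0 < N.p k * N.mu k * t := by positivity
  have := lintegral_plane_ratio (N.two_lt_alpha k) hc
  rw [show (fun y : Plane => ENNReal.ofReal (N.mu k * (t * N.p k * ‖y‖ ^ (-N.alpha k)) /
      (1 + N.mu k * (t * N.p k * ‖y‖ ^ (-N.alpha k))))) = fun y : Plane => ENNReal.ofReal
      (N.p k * N.mu k * t * ‖y‖ ^ (-N.alpha k) / (1 + N.p k * N.mu k * t * ‖y‖ ^ (-N.alpha k)))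
      from funext fun y => by congr 2 <;> ring, this, ← ENNReal.ofReal_mul hl.le,
    Real.mul_rpow (by positivity) ht.le, HetNet.omegaT]
  congr 1; ring

theorem laplaceTotal_eq [IsProbabilityMeasure P] (h : IsNetworkModel N P x Psi)
    {R : Fin (n + 1) → ℝ} (hR : ∀ k, 0 < R k) {t : ℝ} (ht : 0 < t) :
    N.laplaceTotal x Psi P R t = Real.exp (-∑ k, N.omegaT k * t ^ (2 / N.alpha k)) := by
  have hm : Measurable fun ω => N.signal x Psi R ω + N.interference x Psi R ω :=
    (h.measurable_signal R).add (h.measurable_interference R)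
  rw [HetNet.laplaceTotal, integral_eq_lintegral_of_nonneg_ae
    (Filter.Eventually.of_forall fun _ => (Real.exp_pos _).le)
    (Real.measurable_exp.comp (hm.ennreal_toReal.const_mul _)).aestronglyMeasurable,
    ← ENNReal.toReal_ofReal (Real.exp_pos _).le, ← h.lintegral_negExp_total R ht]
  congr 1
  refine lintegral_congr_ae ?_
  -- Finiteness matters because `toReal` sends $\infty$ to $0$, where the real exponential is $1$
  -- and `negExp` is $0$.
  filter_upwards [h.ae_signal_ne_top R, h.ae_interference_ne_top hR] with ω h1 h2
  have h3 := ENNReal.add_ne_top.2 ⟨h1, h2⟩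
  rw [negExp_of_ne_top (ENNReal.mul_ne_top ENNReal.ofReal_ne_top h3), ENNReal.toReal_mul,
    ENNReal.toReal_ofReal ht.le, neg_mul]

theorem clusterPower_eq (h : IsNetworkModel N P x Psi) {R : Fin (n + 1) → ℝ}
    (hR : ∀ k, 0 < R k) :
    N.clusterPower x P R = ENNReal.ofReal (∑ k, N.lam k * Real.pi *
      (N.P0 k + N.Delta k * N.p k + N.Pbh) * R k ^ 2) := by
  have hl := N.lam_pos
  have hc := N.power_pos
  rw [HetNet.clusterPower, ENNReal.ofReal_sum_of_nonneg fun k _ => by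
    have := hc k; have := hl k; positivity]
  refine Finset.sum_congr rfl fun k _ => ?_
  have := hc k; have hl := hl k; have := (hR k).le
  rw [(h.ppp k).lintegral_pointCount Metric.isClosed_closedBall.measurableSet
    (isCompact_closedBall (0 : Plane) (R k)).measure_lt_top.ne,
    EuclideanSpace.volume_closedBall_fin_two, ← ENNReal.ofReal_pow this,
    ← ENNReal.ofReal_mul (by positivity), ← ENNReal.ofReal_mul hl.le,
    ← ENNReal.ofReal_mul (by positivity)]
  congr 1; ring

end IsNetworkModel

/-! ### The lower bound of the rate: Frullani and Jensen -/

theorem lintegral_exp_sub_exp_div {a b : ℝ} (ha : 0 < a) (hab : a ≤ b) :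
    ∫⁻ t in Ioi (0 : ℝ), ENNReal.ofReal ((Real.exp (-t * a) - Real.exp (-t * b)) / t) =
      ENNReal.ofReal (Real.log (b / a)) := by
  have hb : 0 < b := ha.trans_le hab
  -- The integrand is $\int_a^be^{-st}\,ds$; Tonelli then leaves $\int_a^bds/s$.
  have h1 : ∀ t ∈ Ioi (0 : ℝ), ENNReal.ofReal ((Real.exp (-t * a) - Real.exp (-t * b)) / t) =
      ∫⁻ s in Ioc a b, ENNReal.ofReal (Real.exp (-s * t)) := fun t ht => by
    have ht0 : 0 < t := ht
    have hi : ∫ s in a..b, Real.exp (-s * t) = (Real.exp (-t * a) - Real.exp (-t * b)) / t := by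
      rw [intervalIntegral.integral_eq_sub_of_hasDerivAt
        (f := fun s => -Real.exp (-s * t) / t)]
      · rw [mul_comm (-t) a, mul_comm (-t) b, mul_neg, mul_neg, neg_mul, neg_mul]; ring
      · intro s _
        have h := (((hasDerivAt_id s).neg.mul_const t).exp.neg).div_const t
        convert! h using 1
        simp only [Pi.neg_apply, id]
        field_simp
      · exact (by fun_prop : Continuous fun s : ℝ => Real.exp (-s * t)).intervalIntegrable _ _
    rw [← hi, intervalIntegral.integral_of_le hab, ofReal_integral_eq_lintegral_ofReal]
    · exact (by fun_prop : Continuous fun s : ℝ => Real.exp (-s * t)).integrableOn_Ioc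
    · exact Filter.Eventually.of_forall fun s => (Real.exp_pos _).le
  rw [setLIntegral_congr_fun measurableSet_Ioi h1, lintegral_lintegral_swap (by fun_prop)]
  have h2 : ∀ s ∈ Ioc a b, ∫⁻ t in Ioi (0 : ℝ), ENNReal.ofReal (Real.exp (-s * t)) =
      ENNReal.ofReal (1 / s) := fun s hs => lintegral_exp_neg_mul_Ioi (ha.trans hs.1)
  rw [setLIntegral_congr_fun measurableSet_Ioc h2, ← integral_one_div_of_pos ha hb,
    intervalIntegral.integral_of_le hab, ofReal_integral_eq_lintegral_ofReal]
  · refine (ContinuousOn.integrableOn_Icc ?_).mono_set Ioc_subset_Icc_self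
    exact continuousOn_const.div continuousOn_id fun s hs => (ha.trans_le hs.1).ne'
  · filter_upwards [ae_restrict_mem measurableSet_Ioc] with s hs
    have : 0 < s := ha.trans hs.1
    simp only [Pi.zero_apply]; positivity

/-- The Frullani integral for `ln (1 + S / I)`. If `I` vanishes, it is a mere inequality. -/
theorem lintegral_exp_sub_exp_div_le_log {S I : ℝ≥0∞} (hS : S ≠ ∞) (hI : I ≠ ∞) :
    ∫⁻ t in Ioi (0 : ℝ),
      ENNReal.ofReal ((Real.exp (-t * I.toReal) - Real.exp (-t * (S + I).toReal)) / t) ≤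
      (ENNReal.log (1 + S / I)).toENNReal := by
  -- If $I=0<S$ the right side is $\infty$; if both vanish, $0/0=0$ makes both sides $0$.
  by_cases hI0 : I = 0
  · by_cases hS0 : S = 0
    · simp [hI0, hS0]
    · simp [hI0, ENNReal.div_zero hS0]
  · have ha : 0 < I.toReal := ENNReal.toReal_pos hI0 hI
    have hab : I.toReal ≤ (S + I).toReal :=
      ENNReal.toReal_mono (ENNReal.add_ne_top.2 ⟨hS, hI⟩) le_add_self
    have hb : 0 < (S + I).toReal := ha.trans_le hab
    rw [lintegral_exp_sub_exp_div ha hab]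
    have h1 : 1 + S / I = ENNReal.ofReal ((S + I).toReal / I.toReal) := by
      rw [ENNReal.ofReal_div_of_pos ha, ENNReal.ofReal_toReal hI,
        ENNReal.ofReal_toReal (ENNReal.add_ne_top.2 ⟨hS, hI⟩), ENNReal.add_div,
        ENNReal.div_self hI0 hI, add_comm]
    rw [h1, ENNReal.log_ofReal_of_pos (by positivity), EReal.toENNReal_of_ne_top (by simp),
      EReal.toReal_coe]

theorem ofReal_integral_le_lintegral_ofReal {α : Type*} [MeasurableSpace α] {μ : Measure α}
    {f : α → ℝ} (hf : Integrable f μ) :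
    ENNReal.ofReal (∫ a, f a ∂μ) ≤ ∫⁻ a, ENNReal.ofReal (f a) ∂μ := by
  rw [integral_eq_lintegral_pos_part_sub_lintegral_neg_part hf]
  refine (ENNReal.ofReal_le_ofReal (sub_le_self _ ENNReal.toReal_nonneg)).trans ?_
  exact ENNReal.ofReal_toReal_le

theorem integrable_exp_neg_mul_of_nonneg {Ω : Type*} [MeasurableSpace Ω] {P : Measure Ω}
    [IsFiniteMeasure P] {t : ℝ} (ht : 0 ≤ t) {X : Ω → ℝ} (hX : Measurable X)
    (hX0 : ∀ ω, 0 ≤ X ω) : Integrable (fun ω => Real.exp (-t * X ω)) P := by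
  refine Integrable.of_bound (by fun_prop) 1 (Filter.Eventually.of_forall fun ω => ?_)
  rw [Real.norm_eq_abs, abs_of_pos (Real.exp_pos _), Real.exp_le_one_iff]
  nlinarith [mul_nonneg ht (hX0 ω)]

theorem IsNetworkModel.rateBound_le_rate {Ω : Type*} [MeasurableSpace Ω] {n : ℕ} {N : HetNet n}
    {P : Measure Ω} [IsProbabilityMeasure P] {x : Fin (n + 1) → ℕ → Ω → Plane}
    {Psi : Fin (n + 1) → ℕ → Ω → ℝ} (h : IsNetworkModel N P x Psi) {R : Fin (n + 1) → ℝ}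
    (hR : ∀ k, 0 < R k) (hint : IntegrableOn (N.rateBoundIntegrand x Psi P R) (Ioi 0)) :
    ENNReal.ofReal (N.rateBound x Psi P R) ≤ N.rate x Psi P R := by
  set S := N.signal x Psi R
  set I := N.interference x Psi R
  have hSm : Measurable S := h.measurable_signal R
  have hIm : Measurable I := h.measurable_interference R
  have hItop : ∀ᵐ ω ∂P, I ω ≠ ∞ := h.ae_interference_ne_top hR
  have hStop : ∀ᵐ ω ∂P, S ω ≠ ∞ := h.ae_signal_ne_top R
  have hmean : N.meanInterference x Psi P R ≠ ∞ :=
    (h.meanInterference_eq hR).trans_ne ENNReal.ofReal_ne_top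
  have hIint : Integrable (fun ω => (I ω).toReal) P :=
    integrable_toReal_of_lintegral_ne_top hIm.aemeasurable hmean
  have hmeanR : (N.meanInterference x Psi P R).toReal = ∫ ω, (I ω).toReal ∂P :=
    (integral_toReal hIm.aemeasurable (hItop.mono fun ω hω => lt_top_iff_ne_top.2 hω)).symm
  have hstep : ∀ t ∈ Ioi (0 : ℝ), ENNReal.ofReal (N.rateBoundIntegrand x Psi P R t) ≤
      ∫⁻ ω, ENNReal.ofReal
        ((Real.exp (-t * (I ω).toReal) - Real.exp (-t * (S ω + I ω).toReal)) / t) ∂P := by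
    intro t ht
    have ht0 : 0 < t := ht
    have i1 : Integrable (fun ω => Real.exp (-t * (I ω).toReal)) P :=
      integrable_exp_neg_mul_of_nonneg ht0.le hIm.ennreal_toReal fun _ => ENNReal.toReal_nonneg
    have i2 : Integrable (fun ω => Real.exp (-t * (S ω + I ω).toReal)) P :=
      integrable_exp_neg_mul_of_nonneg ht0.le (hSm.add hIm).ennreal_toReal
        fun _ => ENNReal.toReal_nonneg
    -- Jensen's inequality for the exponential; it replaces the Laplace transform of the
    -- interference by the first term of the bound.
    have hJ : Real.exp (-t * ∫ ω, (I ω).toReal ∂P) ≤ ∫ ω, Real.exp (-t * (I ω).toReal) ∂P := by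
      rw [← integral_const_mul]
      exact convexOn_exp.map_integral_le Real.continuous_exp.continuousOn isClosed_univ
        (Filter.Eventually.of_forall fun _ => mem_univ _) (hIint.const_mul _) i1
    refine (ENNReal.ofReal_le_ofReal ?_).trans
      (ofReal_integral_le_lintegral_ofReal ((i1.sub i2).div_const t))
    rw [integral_div, integral_sub i1 i2, HetNet.rateBoundIntegrand, hmeanR]
    exact div_le_div_of_nonneg_right (sub_le_sub_right hJ _) ht0.le
  calc ENNReal.ofReal (N.rateBound x Psi P R)
    _ ≤ ∫⁻ t in Ioi (0 : ℝ), ENNReal.ofReal (N.rateBoundIntegrand x Psi P R t) :=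
      ofReal_integral_le_lintegral_ofReal hint
    _ ≤ ∫⁻ t in Ioi (0 : ℝ), ∫⁻ ω, ENNReal.ofReal
        ((Real.exp (-t * (I ω).toReal) - Real.exp (-t * (S ω + I ω).toReal)) / t) ∂P :=
      setLIntegral_mono' measurableSet_Ioi hstep
    _ = ∫⁻ ω, (∫⁻ t in Ioi (0 : ℝ), ENNReal.ofReal
        ((Real.exp (-t * (I ω).toReal) - Real.exp (-t * (S ω + I ω).toReal)) / t)) ∂P :=
      lintegral_lintegral_swap (by fun_prop)
    _ ≤ N.rate x Psi P R := by
      refine lintegral_mono_ae ?_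
      filter_upwards [hItop, hStop] with ω h1 h2
      exact lintegral_exp_sub_exp_div_le_log h2 h1

/-! ### Closed form of the rate bound -/

/-- From $e^{-a}(1-b)\le e^{-a-b}\le e^{-b}$ and its mirror image. The bound is small for small
$a,b$ and keeps the exponential decay, so that division by $t$ is harmless at both ends. -/
theorem abs_exp_neg_sub_exp_neg_le {a b : ℝ} (ha : 0 ≤ a) (hb : 0 ≤ b) :
    |Real.exp (-a) - Real.exp (-b)| ≤ b * Real.exp (-a) + a * Real.exp (-b) := by
  have h1 := Real.add_one_le_exp (-a)
  have h2 := Real.add_one_le_exp (-b)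
  have h3 : Real.exp (-a) ≤ 1 := Real.exp_le_one_iff.2 (by linarith)
  have h4 : Real.exp (-b) ≤ 1 := Real.exp_le_one_iff.2 (by linarith)
  have h5 := Real.exp_pos (-a)
  have h6 := Real.exp_pos (-b)
  rw [abs_le]
  constructor <;> nlinarith [mul_nonneg ha h6.le, mul_nonneg hb h5.le]

section ExpDifference

variable {m w d : ℝ}

/-- The factor $1+t$ dominates $t^s$ for all $s\in[0,1]$, so one majorant serves the whole limit
$s\to0$. -/
theorem integrableOn_expDifference_majorant (hm : 0 < m) (hw : 0 < w) (hd : 0 < d) :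
    IntegrableOn (fun t : ℝ => (1 + t) *
      (w * (t ^ (d - 1) * Real.exp (-m * t)) + m * Real.exp (-w * t ^ d))) (Ioi 0) := by
  have i1 := (integrableOn_rpow_mul_exp_neg_mul_rpow (s := d - 1)
    (by linarith) one_pos hm).const_mul w
  have i2 := (integrableOn_rpow_mul_exp_neg_mul_rpow (s := d) (by linarith) one_pos hm).const_mul w
  have i3 := (integrableOn_rpow_mul_exp_neg_mul_rpow (s := 0) (by norm_num) hd hw).const_mul m
  have i4 := (integrableOn_rpow_mul_exp_neg_mul_rpow (s := 1) (by norm_num) hd hw).const_mul m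
  refine IntegrableOn.congr_fun (((i1.add i2).add i3).add i4) (fun t ht => ?_) measurableSet_Ioi
  have ht0 : 0 < t := ht
  simp only [Pi.add_apply, Real.rpow_one, Real.rpow_zero, Real.rpow_sub_one ht0.ne']
  field_simp
  ring

theorem abs_rpow_mul_expDifference_le (hm : 0 < m) (hw : 0 < w) {t s : ℝ} (ht : 0 < t)
    (hs0 : 0 ≤ s) (hs1 : s ≤ 1) :
    |t ^ (s - 1) * (Real.exp (-m * t) - Real.exp (-w * t ^ d))| ≤ (1 + t) *
      (w * (t ^ (d - 1) * Real.exp (-m * t)) + m * Real.exp (-w * t ^ d)) := by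
  have h1 : t ^ s ≤ 1 + t := by
    rcases le_total t 1 with h | h
    · linarith [Real.rpow_le_one ht.le h hs0]
    · have := Real.rpow_le_rpow_of_exponent_le h hs1
      rw [Real.rpow_one] at this; linarith
  have h2 := abs_exp_neg_sub_exp_neg_le (a := m * t) (b := w * t ^ d)
    (by positivity) (by positivity)
  rw [← neg_mul, ← neg_mul] at h2
  rw [abs_mul, abs_of_pos (by positivity), Real.rpow_sub_one ht.ne', Real.rpow_sub_one ht.ne']
  calc t ^ s / t * |Real.exp (-m * t) - Real.exp (-w * t ^ d)|
    _ ≤ (1 + t) / t * (w * t ^ d * Real.exp (-m * t) + m * t * Real.exp (-w * t ^ d)) := by gcongr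
    _ = _ := by field_simp

theorem integrableOn_expDifference (hm : 0 < m) (hw : 0 < w) (hd : 0 < d) :
    IntegrableOn (fun t : ℝ => (Real.exp (-m * t) - Real.exp (-w * t ^ d)) / t) (Ioi 0) := by
  refine Integrable.mono' (integrableOn_expDifference_majorant hm hw hd)
    (Measurable.aestronglyMeasurable (by fun_prop)) ?_
  filter_upwards [ae_restrict_mem measurableSet_Ioi] with t ht
  have := abs_rpow_mul_expDifference_le (d := d) hm hw ht le_rfl zero_le_one
  rwa [zero_sub, Real.rpow_neg_one, ← div_eq_inv_mul] at this

/-- By $\Gamma(s+1)=s\Gamma(s)$ the two Gamma integrals share the factor $s^{-1}$. The bracket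
vanishes at $s=0$, so the right side is a difference quotient. -/
theorem integral_rpow_mul_expDifference (hm : 0 < m) (hw : 0 < w) (hd : 0 < d) {s : ℝ}
    (hs : 0 < s) :
    ∫ t in Ioi (0 : ℝ), t ^ (s - 1) * (Real.exp (-m * t) - Real.exp (-w * t ^ d)) =
      s⁻¹ * (m ^ (-s) * Real.Gamma (s + 1) - w ^ (-(s / d)) * Real.Gamma (s / d + 1)) := by
  have i1 := integrableOn_rpow_mul_exp_neg_mul_rpow (s := s - 1) (by linarith) one_pos hm
  have i2 := integrableOn_rpow_mul_exp_neg_mul_rpow (s := s - 1) (by linarith) hd hw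
  have e1 := integral_rpow_mul_exp_neg_mul_rpow one_pos (q := s - 1) (by linarith) hm
  have e2 := integral_rpow_mul_exp_neg_mul_rpow hd (q := s - 1) (by linarith) hw
  simp only [Real.rpow_one] at i1 e1
  simp_rw [mul_sub]
  rw [integral_sub i1 i2, e1, e2, Real.Gamma_add_one hs.ne', Real.Gamma_add_one (by positivity)]
  simp only [sub_add_cancel, neg_div, div_one]
  field_simp

/-- The regularization `t ^ s`, `s → 0`, and the derivative of the Gamma function at `1`. -/
theorem integral_expDifference (hm : 0 < m) (hw : 0 < w) (hd : 0 < d) :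
    ∫ t in Ioi (0 : ℝ), (Real.exp (-m * t) - Real.exp (-w * t ^ d)) / t =
      (1 / d - 1) * Real.eulerMascheroniConstant - Real.log m + 1 / d * Real.log w := by
  have hlim : Filter.Tendsto
      (fun s : ℝ => ∫ t in Ioi (0 : ℝ), t ^ (s - 1) * (Real.exp (-m * t) - Real.exp (-w * t ^ d)))
      (nhdsWithin 0 (Ioi 0))
      (nhds (∫ t in Ioi (0 : ℝ), (Real.exp (-m * t) - Real.exp (-w * t ^ d)) / t)) := by
    refine tendsto_integral_filter_of_dominated_convergence _
      (Filter.Eventually.of_forall fun s => Measurable.aestronglyMeasurable (by fun_prop)) ?_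
      (integrableOn_expDifference_majorant hm hw hd) ?_
    · filter_upwards [Ioo_mem_nhdsGT (one_pos : (0 : ℝ) < 1)] with s hs
      filter_upwards [ae_restrict_mem measurableSet_Ioi] with t ht
      exact abs_rpow_mul_expDifference_le hm hw ht hs.1.le hs.2.le
    · filter_upwards [ae_restrict_mem measurableSet_Ioi] with t ht
      have ht0 : 0 < t := ht
      have hc : Continuous fun s : ℝ =>
          t ^ (s - 1) * (Real.exp (-m * t) - Real.exp (-w * t ^ d)) :=
        ((Real.continuous_const_rpow ht0.ne').comp (continuous_id.sub continuous_const)).mul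
          continuous_const
      have := (hc.tendsto 0).mono_left (nhdsWithin_le_nhds (s := Ioi 0))
      rwa [zero_sub, Real.rpow_neg_one, ← div_eq_inv_mul] at this
  have hder : HasDerivAt (fun s : ℝ => m ^ (-s) * Real.Gamma (s + 1) -
      w ^ (-(s / d)) * Real.Gamma (s / d + 1))
      ((1 / d - 1) * Real.eulerMascheroniConstant - Real.log m + 1 / d * Real.log w) 0 := by
    have key : ∀ {c e : ℝ}, 0 < c → HasDerivAt
        (fun s : ℝ => c ^ (-(s / e)) * Real.Gamma (s / e + 1))
        ((-Real.log c - Real.eulerMascheroniConstant) / e) 0 := fun {c e} hc => by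
      have g1 : HasDerivAt (fun s : ℝ => s / e) (1 / e) 0 := (hasDerivAt_id _).div_const e
      have g2 : HasDerivAt (fun s : ℝ => c ^ (-(s / e)))
          (Real.log c * (-(1 / e)) * c ^ (-(0 / e))) 0 := g1.neg.const_rpow hc
      have g3 : HasDerivAt Real.Gamma (-Real.eulerMascheroniConstant) ((0 : ℝ) / e + 1) := by
        simpa using Real.hasDerivAt_Gamma_one
      have g4 := g2.mul (g3.comp (0 : ℝ) (g1.add_const 1))
      convert! g4 using 1
      simp
      ring
    have h1 := key (e := 1) hm
    simp only [div_one] at h1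
    convert! h1.sub (key (e := d) hw) using 1
    ring
  -- As $s\to0^+$ the quotient tends to the derivative of the bracket at $0$; $\Gamma'(1)=-C$ brings
  -- in Euler's constant.
  have hslope := hder.tendsto_slope_zero_right
  refine tendsto_nhds_unique hlim (hslope.congr' ?_)
  filter_upwards [self_mem_nhdsWithin] with s hs
  rw [integral_rpow_mul_expDifference hm hw hd hs]
  simp

end ExpDifference

namespace HetNet

variable {n : ℕ} (N : HetNet n)

theorem integrableOn_ThetaTIntegrand (l : Fin (n + 1)) :
    IntegrableOn (N.ThetaTIntegrand l) (Ioi 0) := by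
  have hα : ∀ k, 0 < 2 / N.alpha k := fun k => div_pos two_pos (by linarith [N.two_lt_alpha k])
  -- The majorant comes from $1-e^{-u}\le u$; each of its terms is a Gamma integrand.
  have hmaj : IntegrableOn (fun t : ℝ => ∑ k ∈ Finset.univ.erase l, N.omegaT k *
      (t ^ (2 / N.alpha k - 1) * Real.exp (-N.omegaT l * t ^ (2 / N.alpha l)))) (Ioi 0) :=
    integrable_finsetSum _ fun k _ => (integrableOn_rpow_mul_exp_neg_mul_rpow
      (by linarith [hα k]) (hα l) (N.omegaT_pos l)).const_mul _
  refine Integrable.mono' hmaj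
    (Measurable.aestronglyMeasurable (by unfold ThetaTIntegrand; fun_prop)) ?_
  filter_upwards [ae_restrict_mem measurableSet_Ioi] with t ht
  have ht0 : 0 < t := ht
  set u := ∑ k ∈ Finset.univ.erase l, N.omegaT k * t ^ (2 / N.alpha k) with hu
  have hu0 : 0 ≤ u := Finset.sum_nonneg fun k _ => mul_nonneg (N.omegaT_pos k).le (by positivity)
  have h1 : Real.exp (-u) ≤ 1 := Real.exp_le_one_iff.2 (by linarith)
  have h2 := Real.add_one_le_exp (-u)
  have h3 := Real.exp_pos (-N.omegaT l * t ^ (2 / N.alpha l))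
  rw [ThetaTIntegrand, ← hu, Real.norm_eq_abs,
    abs_of_nonneg (mul_nonneg (by positivity) (by linarith))]
  calc Real.exp (-N.omegaT l * t ^ (2 / N.alpha l)) / t * (1 - Real.exp (-u))
    _ ≤ Real.exp (-N.omegaT l * t ^ (2 / N.alpha l)) / t * u := by gcongr; linarith
    _ = _ := by
      rw [hu, Finset.mul_sum]
      refine Finset.sum_congr rfl fun k _ => ?_
      rw [Real.rpow_sub_one ht0.ne']
      ring

/-- The mean interference as a function of the radii. -/
noncomputable def interferenceMean (R : Fin (n + 1) → ℝ) : ℝ :=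
  ∑ k, 2 * Real.pi / (N.alpha k - 2) * N.p k * N.mu k * N.lam k * R k ^ (2 - N.alpha k)

theorem interferenceMean_pos {R : Fin (n + 1) → ℝ} (hR : ∀ k, 0 < R k) :
    0 < N.interferenceMean R :=
  Finset.sum_pos (fun k _ => by
    have : 0 < N.alpha k - 2 := by linarith [N.two_lt_alpha k]
    have := N.p_pos k; have := N.mu_pos k; have := N.lam_pos k; have := hR k
    positivity) Finset.univ_nonempty

end HetNet

namespace IsNetworkModel

variable {Ω : Type*} [MeasurableSpace Ω] {n : ℕ} {N : HetNet n} {P : Measure Ω}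
  [IsProbabilityMeasure P] {x : Fin (n + 1) → ℕ → Ω → Plane} {Psi : Fin (n + 1) → ℕ → Ω → ℝ}

/-- Adding and subtracting $e^{-\tilde\omega_lt^{2/\alpha_l}}$ isolates the dependence on the radii
in a difference of two exponentials. -/
theorem rateBoundIntegrand_eq (h : IsNetworkModel N P x Psi) (l : Fin (n + 1))
    {R : Fin (n + 1) → ℝ} (hR : ∀ k, 0 < R k) {t : ℝ} (ht : 0 < t) :
    N.rateBoundIntegrand x Psi P R t = (Real.exp (-N.interferenceMean R * t) -
      Real.exp (-N.omegaT l * t ^ (2 / N.alpha l))) / t + N.ThetaTIntegrand l t := by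
  rw [HetNet.rateBoundIntegrand, h.laplaceTotal_eq hR ht, h.meanInterference_eq hR,
    ← HetNet.interferenceMean, ENNReal.toReal_ofReal (N.interferenceMean_pos hR).le,
    HetNet.ThetaTIntegrand, ← Finset.add_sum_erase _ _ (Finset.mem_univ l), neg_add, Real.exp_add,
    neg_mul, neg_mul, neg_mul, mul_comm t]
  ring

theorem integrableOn_rateBoundIntegrand (h : IsNetworkModel N P x Psi)
    {R : Fin (n + 1) → ℝ} (hR : ∀ k, 0 < R k) :
    IntegrableOn (N.rateBoundIntegrand x Psi P R) (Ioi 0) := by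
  have hα : 0 < 2 / N.alpha 0 := div_pos two_pos (by linarith [N.two_lt_alpha 0])
  exact ((integrableOn_expDifference (N.interferenceMean_pos hR) (N.omegaT_pos 0) hα).add
    (N.integrableOn_ThetaTIntegrand 0)).congr_fun
    (fun t ht => (h.rateBoundIntegrand_eq 0 hR ht).symm) measurableSet_Ioi

theorem rateBound_eq (h : IsNetworkModel N P x Psi) (l : Fin (n + 1))
    {R : Fin (n + 1) → ℝ} (hR : ∀ k, 0 < R k) :
    N.rateBound x Psi P R = (N.alpha l - 2) / 2 * Real.eulerMascheroniConstant + N.ThetaT l +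
      N.alpha l / 2 * Real.log (N.omegaT l) - Real.log (N.interferenceMean R) := by
  have hα' : 0 < N.alpha l := by linarith [N.two_lt_alpha l]
  have hα : 0 < 2 / N.alpha l := by positivity
  rw [HetNet.rateBound, setIntegral_congr_fun measurableSet_Ioi
    fun t ht => h.rateBoundIntegrand_eq l hR ht, integral_add
    (integrableOn_expDifference (N.interferenceMean_pos hR) (N.omegaT_pos l) hα)
    (N.integrableOn_ThetaTIntegrand l),
    integral_expDifference (N.interferenceMean_pos hR) (N.omegaT_pos l) hα, HetNet.ThetaT]
  field_simp
  ring

end IsNetworkModel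

/-! ### Constrained minimization by a Lagrange multiplier -/

/-- Add $v>1+\ln v$ and $v^{-b}/b\ge1/b-\ln v$; the logarithms cancel. -/
theorem one_add_inv_lt_add_rpow_neg {b v : ℝ} (hb : 0 < b) (hv : 0 < v) (hv1 : v ≠ 1) :
    1 + 1 / b < v + 1 / b * v ^ (-b) := by
  have h1 := Real.log_lt_sub_one_of_pos hv hv1
  have h2 := Real.add_one_le_exp (Real.log v * -b)
  rw [← Real.rpow_def_of_pos hv] at h2
  have h3 : 1 / b * (Real.log v * -b + 1) ≤ 1 / b * v ^ (-b) := by gcongr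
  have h4 : 1 / b * (Real.log v * -b + 1) = 1 / b - Real.log v := by field_simp; ring
  linarith

/-- The Lagrangian of one coordinate has a strict minimum at `r` if `r ^ a = κ q`. -/
theorem lagrangian_lt {a A q κ r r' : ℝ} (ha : 2 < a) (hA : 0 < A) (hq : 0 < q)
    (hr : 0 < r) (hr' : 0 < r') (hne : r' ≠ r) (hκ : r ^ a = κ * q) :
    A * (a - 2) / (2 * q) * r ^ 2 + κ * (A * r ^ (2 - a)) <
      A * (a - 2) / (2 * q) * r' ^ 2 + κ * (A * r' ^ (2 - a)) := by
  have ha2 : 0 < a - 2 := by linarith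
  -- In this variable the cost is linear and the constraint term is a multiple of $v^{-(a-2)/2}$.
  set v := (r' / r) ^ 2 with hv
  have hv0 : 0 < v := by positivity
  have hv1 : v ≠ 1 := fun h => hne <| by
    have := (pow_eq_one_iff_of_nonneg (by positivity) two_ne_zero).1 h
    rwa [div_eq_one_iff_eq hr.ne'] at this
  have hκ' : κ = r ^ a / q := by rw [hκ]; field_simp
  have e1 : r ^ (2 - a) = r ^ 2 / r ^ a := by
    rw [Real.rpow_sub hr, Real.rpow_two]
  have e2 : r' ^ (2 - a) = r ^ (2 - a) * v ^ (-((a - 2) / 2)) := by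
    rw [hv, ← Real.rpow_natCast (r' / r) 2, ← Real.rpow_mul (by positivity),
      show ((2 : ℕ) : ℝ) * -((a - 2) / 2) = 2 - a by push_cast; ring,
      Real.div_rpow hr'.le hr.le]
    field_simp
  have e3 : r' ^ 2 = r ^ 2 * v := by rw [hv]; field_simp
  have hra : 0 < r ^ a := by positivity
  have key := one_add_inv_lt_add_rpow_neg (b := (a - 2) / 2) (by positivity) hv0 hv1
  have hC : 0 < A * (a - 2) / (2 * q) * r ^ 2 := by positivity
  rw [e2, e3, e1, hκ']
  calc A * (a - 2) / (2 * q) * r ^ 2 + r ^ a / q * (A * (r ^ 2 / r ^ a))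
    _ = A * (a - 2) / (2 * q) * r ^ 2 * (1 + 1 / ((a - 2) / 2)) := by field_simp
    _ < A * (a - 2) / (2 * q) * r ^ 2 * (v + 1 / ((a - 2) / 2) * v ^ (-((a - 2) / 2))) := by
      gcongr
    _ = _ := by field_simp

section Optimization

variable {ι : Type*} [Fintype ι] {a A q : ι → ℝ}

/-- Weak duality: the Lagrangian is strictly smaller at `r`, and since $\kappa>0$ the constraint
term at `r'` cannot make up for it. -/
theorem sum_sq_lt_of_constraint (ha : ∀ k, 2 < a k) (hA : ∀ k, 0 < A k) (hq : ∀ k, 0 < q k)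
    {κ : ℝ} (hκ : 0 < κ) {r r' : ι → ℝ} (hr : ∀ k, 0 < r k) (hr' : ∀ k, 0 < r' k)
    (hrκ : ∀ k, r k ^ a k = κ * q k)
    (hle : ∑ k, A k * r' k ^ (2 - a k) ≤ ∑ k, A k * r k ^ (2 - a k)) (hne : r' ≠ r) :
    ∑ k, A k * (a k - 2) / (2 * q k) * r k ^ 2 < ∑ k, A k * (a k - 2) / (2 * q k) * r' k ^ 2 := by
  obtain ⟨j, hj⟩ := Function.ne_iff.1 hne
  have hlag : ∑ k, (A k * (a k - 2) / (2 * q k) * r k ^ 2 + κ * (A k * r k ^ (2 - a k))) <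
      ∑ k, (A k * (a k - 2) / (2 * q k) * r' k ^ 2 + κ * (A k * r' k ^ (2 - a k))) := by
    refine Finset.sum_lt_sum (fun k _ => ?_) ⟨j, Finset.mem_univ j,
      lagrangian_lt (ha j) (hA j) (hq j) (hr j) (hr' j) hj (hrκ j)⟩
    by_cases hk : r' k = r k
    · rw [hk]
    · exact (lagrangian_lt (ha k) (hA k) (hq k) (hr k) (hr' k) hk (hrκ k)).le
  rw [Finset.sum_add_distrib, Finset.sum_add_distrib, ← Finset.mul_sum, ← Finset.mul_sum] at hlag
  have := mul_le_mul_of_nonneg_left hle hκ.le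
  linarith

theorem strictAntiOn_sum_rpow [Nonempty ι] (ha : ∀ k, 2 < a k) (hA : ∀ k, 0 < A k)
    (hq : ∀ k, 0 < q k) :
    StrictAntiOn (fun κ : ℝ => ∑ k, A k * (κ * q k) ^ ((2 - a k) / a k)) (Ioi 0) := by
  intro κ hκ κ' _ hlt
  refine Finset.sum_lt_sum_of_nonempty Finset.univ_nonempty fun k _ => ?_
  have hκ0 : 0 < κ := hκ
  have := hq k
  exact mul_lt_mul_of_pos_left (Real.rpow_lt_rpow_of_neg (by positivity) (by gcongr)
    (div_neg_of_neg_of_pos (by linarith [ha k]) (by linarith [ha k]))) (hA k)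

theorem exists_sum_rpow_eq [Nonempty ι] (ha : ∀ k, 2 < a k) (hA : ∀ k, 0 < A k)
    (hq : ∀ k, 0 < q k) {M : ℝ} (hM : 0 < M) :
    ∃ κ : ℝ, 0 < κ ∧ ∑ k, A k * (κ * q k) ^ ((2 - a k) / a k) = M := by
  have hneg : ∀ k, (2 - a k) / a k < 0 := fun k =>
    div_neg_of_neg_of_pos (by linarith [ha k]) (by linarith [ha k])
  have hc : ContinuousOn (fun κ : ℝ => ∑ k, A k * (κ * q k) ^ ((2 - a k) / a k)) (Ioi 0) :=
    continuousOn_finsetSum _ fun k _ => continuousOn_const.mul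
      ((continuousOn_id.mul continuousOn_const).rpow_const fun κ hκ =>
        Or.inl (mul_pos hκ (hq k)).ne')
  have hlim : Filter.Tendsto (fun κ : ℝ => ∑ k, A k * (κ * q k) ^ ((2 - a k) / a k))
      Filter.atTop (nhds (∑ k, A k * 0)) := by
    refine tendsto_finsetSum _ fun k _ => Filter.Tendsto.const_mul _ ?_
    have h1 := tendsto_rpow_neg_atTop (y := -((2 - a k) / a k)) (by linarith [hneg k])
    rw [neg_neg] at h1
    exact h1.comp (Filter.tendsto_id.atTop_mul_const (hq k))
  simp only [mul_zero, Finset.sum_const_zero] at hlim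
  obtain ⟨κ₂, hκ₂M, hκ₂⟩ :=
    ((hlim.eventually (gt_mem_nhds hM)).and (Filter.eventually_gt_atTop 0)).exists
  obtain ⟨j⟩ := ‹Nonempty ι›
  -- Chosen so that the `j`-th summand alone equals `M`; the others are positive.
  set κ₁ := (M / A j) ^ ((2 - a j) / a j)⁻¹ / q j with hκ₁
  have hκ₁0 : 0 < κ₁ := by have := hA j; have := hq j; positivity
  have hκ₁M : M ≤ ∑ k, A k * (κ₁ * q k) ^ ((2 - a k) / a k) := by
    have hj : A j * (κ₁ * q j) ^ ((2 - a j) / a j) = M := by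
      have := hA j; have := hq j
      rw [hκ₁, div_mul_cancel₀ _ (hq j).ne', Real.rpow_inv_rpow (by positivity) (hneg j).ne]
      field_simp
    rw [← hj]
    exact Finset.single_le_sum (f := fun k => A k * (κ₁ * q k) ^ ((2 - a k) / a k))
      (fun k _ => by have := hA k; have := hq k; positivity) (Finset.mem_univ j)
  obtain ⟨κ, hκ, hκM⟩ := isPreconnected_Ioi.intermediate_value hκ₂ hκ₁0 hc ⟨hκ₂M.le, hκ₁M⟩
  exact ⟨κ, hκ, hκM⟩

end Optimization

/-! ### The constants of the system and the optimal radii -/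

namespace HetNet

variable {n : ℕ} (N : HetNet n)

/-- Mean received power of a base station per unit of consumed power, at unit distance. -/
noncomputable def powerRatio (k : Fin (n + 1)) : ℝ :=
  N.p k * N.mu k / (N.P0 k + N.Delta k * N.p k + N.Pbh)

theorem powerRatio_pos (k : Fin (n + 1)) : 0 < N.powerRatio k := by
  have := N.p_pos k; have := N.mu_pos k; have := N.power_pos k
  unfold powerRatio; positivity

/-- The coefficients of the mean interference. -/
noncomputable def interferenceCoeff (k : Fin (n + 1)) : ℝ :=
  2 * Real.pi / (N.alpha k - 2) * N.p k * N.mu k * N.lam k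

theorem interferenceCoeff_pos (k : Fin (n + 1)) : 0 < N.interferenceCoeff k := by
  have : 0 < N.alpha k - 2 := by linarith [N.two_lt_alpha k]
  have := N.p_pos k; have := N.mu_pos k; have := N.lam_pos k
  unfold interferenceCoeff; positivity

/-- Brings the cost into the form for which stationarity of the Lagrangian reads
$R_k^{\alpha_k}=\kappa q_k$. -/
theorem power_coeff_eq (k : Fin (n + 1)) :
    N.lam k * Real.pi * (N.P0 k + N.Delta k * N.p k + N.Pbh) =
      N.interferenceCoeff k * (N.alpha k - 2) / (2 * N.powerRatio k) := by
  have : 0 < N.alpha k - 2 := by linarith [N.two_lt_alpha k]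
  have := N.p_pos k; have := N.mu_pos k; have := N.power_pos k
  unfold interferenceCoeff powerRatio
  field_simp

theorem interferenceMean_eq {R : Fin (n + 1) → ℝ} (hR : ∀ k, 0 < R k) {κ : ℝ}
    (hκ : ∀ k, R k ^ N.alpha k = κ * N.powerRatio k) :
    N.interferenceMean R =
      ∑ k, N.interferenceCoeff k * (κ * N.powerRatio k) ^ ((2 - N.alpha k) / N.alpha k) := by
  refine Finset.sum_congr rfl fun k _ => ?_
  have : N.alpha k ≠ 0 := by linarith [N.two_lt_alpha k]
  rw [← hκ, ← Real.rpow_mul (hR k).le, interferenceCoeff, mul_div_cancel₀ _ this]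

/-- The largest mean interference for which the rate bound is at least `tau0`. -/
noncomputable def interferenceBudget (l : Fin (n + 1)) (tau0 : ℝ) : ℝ :=
  N.interferenceCoeff (Fin.last n) * (N.DT l * Real.exp ((N.alpha l - 2) / 2 *
    Real.eulerMascheroniConstant + N.ThetaT l - tau0))

theorem interferenceBudget_eq (l : Fin (n + 1)) (tau0 : ℝ) :
    N.interferenceBudget l tau0 = Real.exp ((N.alpha l - 2) / 2 *
      Real.eulerMascheroniConstant + N.ThetaT l +
        N.alpha l / 2 * Real.log (N.omegaT l) - tau0) := by
  have h0 := (N.interferenceCoeff_pos (Fin.last n)).ne'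
  have e : N.interferenceCoeff (Fin.last n) * N.DT l = N.omegaT l ^ (N.alpha l / 2) := by
    rw [DT, show 2 * Real.pi / (N.alpha (Fin.last n) - 2) * N.lam (Fin.last n) *
      N.p (Fin.last n) * N.mu (Fin.last n) = N.interferenceCoeff (Fin.last n) by
        rw [interferenceCoeff]; ring]
    field_simp
  rw [interferenceBudget, ← mul_assoc, e, Real.rpow_def_of_pos (N.omegaT_pos l), ← Real.exp_add]
  congr 1; ring

/-- Multiply by the interference coefficient of the last tier and use $\tilde\Omega_{j\to
k}=q_k/q_j$. Equation `k` becomes the scalar equation for the multiplier, evaluated at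
$R_k^{\alpha_k}/q_k$. -/
theorem system_iff (l : Fin (n + 1)) (tau0 : ℝ) {R : Fin (n + 1) → ℝ} (hR : ∀ k, 0 < R k)
    (k : Fin (n + 1)) :
    ∑ j, N.BT j * N.OmegaT j k ^ ((N.alpha j - 2) / N.alpha j) *
        R k ^ (N.alpha k * (2 - N.alpha j) / N.alpha j) =
      N.DT l * Real.exp ((N.alpha l - 2) / 2 * Real.eulerMascheroniConstant +
        N.ThetaT l - tau0) ↔
    ∑ j, N.interferenceCoeff j * (R k ^ N.alpha k / N.powerRatio k * N.powerRatio j) ^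
      ((2 - N.alpha j) / N.alpha j) = N.interferenceBudget l tau0 := by
  have h0 := N.interferenceCoeff_pos (Fin.last n)
  rw [interferenceBudget, ← mul_right_inj' h0.ne', Finset.mul_sum]
  refine Eq.congr (Finset.sum_congr rfl fun j _ => ?_) rfl
  have hq := N.powerRatio_pos
  have hΩ : N.OmegaT j k = N.powerRatio k / N.powerRatio j := by
    have := N.p_pos j; have := N.mu_pos j; have := N.power_pos j; have := N.power_pos k
    unfold OmegaT powerRatio
    field_simp
  have hB : N.interferenceCoeff (Fin.last n) * N.BT j = N.interferenceCoeff j := by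
    have : 0 < N.alpha j - 2 := by linarith [N.two_lt_alpha j]
    have : 0 < N.alpha (Fin.last n) - 2 := by linarith [N.two_lt_alpha (Fin.last n)]
    have := N.p_pos (Fin.last n); have := N.mu_pos (Fin.last n); have := N.lam_pos (Fin.last n)
    unfold BT interferenceCoeff
    field_simp
  have hqk := hq k
  have hqj := hq j
  have hRk := hR k
  rw [← mul_assoc, ← mul_assoc, hB, mul_assoc, hΩ]
  congr 1
  rw [mul_div_assoc (N.alpha k), Real.rpow_mul hRk.le,
    show (N.alpha j - 2) / N.alpha j = -((2 - N.alpha j) / N.alpha j) by ring,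
    Real.rpow_neg (by positivity), ← Real.inv_rpow (by positivity),
    ← Real.mul_rpow (by positivity) (by positivity)]
  congr 1
  field_simp

end HetNet

theorem IsNetworkModel.feasible_iff {Ω : Type*} [MeasurableSpace Ω] {n : ℕ} {N : HetNet n}
    {P : Measure Ω} [IsProbabilityMeasure P] {x : Fin (n + 1) → ℕ → Ω → Plane}
    {Psi : Fin (n + 1) → ℕ → Ω → ℝ} (h : IsNetworkModel N P x Psi) (l : Fin (n + 1)) (tau0 : ℝ)
    {R : Fin (n + 1) → ℝ} (hR : ∀ k, 0 < R k) :
    N.Feasible x Psi P tau0 R ↔ N.interferenceMean R ≤ N.interferenceBudget l tau0 := by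
  rw [HetNet.Feasible, h.rateBound_eq l hR, N.interferenceBudget_eq,
    ← Real.log_le_iff_le_exp (N.interferenceMean_pos hR), and_iff_right hR]
  constructor <;> intro h <;> linarith

/-- There is exactly one optimal vector of radii, and it is the solution of the system. -/
theorem IsNetworkModel.exists_optimal {Ω : Type*} [MeasurableSpace Ω] {n : ℕ} {N : HetNet n}
    {P : Measure Ω} [IsProbabilityMeasure P] {x : Fin (n + 1) → ℕ → Ω → Plane}
    {Psi : Fin (n + 1) → ℕ → Ω → ℝ} (h : IsNetworkModel N P x Psi) (l : Fin (n + 1)) (tau0 : ℝ) :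
    ∃ Rs : Fin (n + 1) → ℝ, (∀ R, N.IsOptimal x Psi P tau0 R ↔ R = Rs) ∧
      ∀ R : Fin (n + 1) → ℝ, (∀ k, 0 < R k) → (R = Rs ↔
        ∀ k, ∑ j, N.BT j * N.OmegaT j k ^ ((N.alpha j - 2) / N.alpha j) *
              R k ^ (N.alpha k * (2 - N.alpha j) / N.alpha j) =
            N.DT l * Real.exp ((N.alpha l - 2) / 2 * Real.eulerMascheroniConstant +
              N.ThetaT l - tau0)) := by
  have hα : ∀ k, N.alpha k ≠ 0 := fun k => by linarith [N.two_lt_alpha k]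
  have hq := N.powerRatio_pos
  have hA := N.interferenceCoeff_pos
  obtain ⟨κ, hκ, hκM⟩ := exists_sum_rpow_eq N.two_lt_alpha hA hq
    (M := N.interferenceBudget l tau0) (by rw [N.interferenceBudget_eq]; exact Real.exp_pos _)
  set Rs : Fin (n + 1) → ℝ := fun k => (κ * N.powerRatio k) ^ (N.alpha k)⁻¹ with hRsd
  have hRs : ∀ k, 0 < Rs k := fun k => Real.rpow_pos_of_pos (mul_pos hκ (hq k)) _
  have hRsκ : ∀ k, Rs k ^ N.alpha k = κ * N.powerRatio k := fun k =>
    Real.rpow_inv_rpow (mul_pos hκ (hq k)).le (hα k)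
  have hmean : N.interferenceMean Rs = N.interferenceBudget l tau0 := by
    rw [N.interferenceMean_eq hRs hRsκ, hκM]
  have hfeas : N.Feasible x Psi P tau0 Rs := (h.feasible_iff l tau0 hRs).2 hmean.le
  have hlt : ∀ R, N.Feasible x Psi P tau0 R → R ≠ Rs →
      N.clusterPower x P Rs < N.clusterPower x P R := fun R hR hne => by
    have hle := ((h.feasible_iff l tau0 hR.1).1 hR).trans_eq hmean.symm
    rw [h.clusterPower_eq hRs, h.clusterPower_eq hR.1]
    simp_rw [N.power_coeff_eq]
    have hs := sum_sq_lt_of_constraint N.two_lt_alpha hA hq hκ hRs hR.1 hRsκ hle hne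
    refine (ENNReal.ofReal_lt_ofReal_iff_of_nonneg (Finset.sum_nonneg fun k _ => ?_)).2 hs
    have : 0 < N.alpha k - 2 := by linarith [N.two_lt_alpha k]
    have := hA k; have := hq k
    positivity
  have hopt : N.IsOptimal x Psi P tau0 Rs := ⟨hfeas, fun R hR => by
    by_cases hne : R = Rs
    · rw [hne]
    · exact (hlt R hR hne).le⟩
  refine ⟨Rs, fun R => ⟨fun hR => ?_, fun hR => hR ▸ hopt⟩, fun R hR => ?_⟩
  · by_contra hne
    exact (hlt R hR.1 hne).not_ge (hR.2 Rs hfeas)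
  · simp_rw [fun k => N.system_iff l tau0 hR k, ← hκM]
    have hinj := (strictAntiOn_sum_rpow N.two_lt_alpha hA hq).injOn
    constructor
    · rintro rfl k
      rw [hRsκ k, mul_div_cancel_right₀ _ (hq k).ne']
    · intro hsys
      funext k
      -- Injectivity in the multiplier makes the candidates of all tiers equal to the same `κ`.
      have hk : R k ^ N.alpha k / N.powerRatio k = κ :=
        hinj (div_pos (Real.rpow_pos_of_pos (hR k) _) (hq k)) hκ (hsys k)
      rw [div_eq_iff (hq k).ne'] at hk
      simp only [hRsd]
      rw [← hk, Real.rpow_rpow_inv (hR k).le (hα k)]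

theorem proposition3 {n : ℕ} (N : HetNet n) {Ω : Type*} [MeasurableSpace Ω] (P : Measure Ω)
    [IsProbabilityMeasure P] (x : Fin (n + 1) → ℕ → Ω → Plane) (Psi : Fin (n + 1) → ℕ → Ω → ℝ)
    (hmodel : IsNetworkModel N P x Psi) (tau0 : ℝ) :
    -- the bound of the rate is well defined, and it is a lower bound of the rate
    (∀ R : Fin (n + 1) → ℝ, (∀ k, 0 < R k) →
      N.meanInterference x Psi P R ≠ ∞ ∧
      IntegrableOn (N.rateBoundIntegrand x Psi P R) (Ioi 0) ∧
      ENNReal.ofReal (N.rateBound x Psi P R) ≤ N.rate x Psi P R) ∧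
    (∀ l, IntegrableOn (N.ThetaTIntegrand l) (Ioi 0)) ∧
    -- optimal radii exist, they are unique, and they meet the requirement on the rate
    (∃! R : Fin (n + 1) → ℝ, N.IsOptimal x Psi P tau0 R) ∧
    (∀ R : Fin (n + 1) → ℝ, N.IsOptimal x Psi P tau0 R →
      ENNReal.ofReal tau0 ≤ N.rate x Psi P R) ∧
    -- for every choice of `l`, positive radii are optimal iff they solve the system of equations
    (∀ (l : Fin (n + 1)) (R : Fin (n + 1) → ℝ), (∀ k, 0 < R k) →
      (N.IsOptimal x Psi P tau0 R ↔
        ∀ k, ∑ j, N.BT j * N.OmegaT j k ^ ((N.alpha j - 2) / N.alpha j) *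
              R k ^ (N.alpha k * (2 - N.alpha j) / N.alpha j) =
            N.DT l * Real.exp ((N.alpha l - 2) / 2 * Real.eulerMascheroniConstant +
              N.ThetaT l - tau0))) := by
  refine ⟨fun R hR => ⟨(hmodel.meanInterference_eq hR).trans_ne ENNReal.ofReal_ne_top,
    hmodel.integrableOn_rateBoundIntegrand hR,
    hmodel.rateBound_le_rate hR (hmodel.integrableOn_rateBoundIntegrand hR)⟩,
    N.integrableOn_ThetaTIntegrand, ?_, fun R hR => ?_, fun l R hR => ?_⟩
  · obtain ⟨Rs, hRs, -⟩ := hmodel.exists_optimal 0 tau0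
    exact ⟨Rs, (hRs Rs).2 rfl, fun R hR => (hRs R).1 hR⟩
  · exact (ENNReal.ofReal_le_ofReal hR.1.2).trans
      (hmodel.rateBound_le_rate hR.1.1 (hmodel.integrableOn_rateBoundIntegrand hR.1.1))
  · obtain ⟨Rs, hRs, hsys⟩ := hmodel.exists_optimal l tau0
    rw [hRs, hsys R hR]
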